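/- All graphs are finite, simple and undirected; a graph class is a class of graphs closed under isomorphism, and it is hereditary if it is closed under induced subgraphs. For graph classes $\Pi_1,\dots,\Pi_d$, the problem $(\Pi_1,\dots,\Pi_d)$ Vertex Deletion asks, given a graph $G$ and an integer $k\ge 0$ (the parameter), whether there is a set $Z\subseteq V(G)$ with $|Z|\le k$ such that every connected component of $G-Z$ belongs to at least one of $\Pi_1,\dots,\Pi_d$. The problem $\Pi_i$ Vertex Deletion is the case of the single class $\Pi_i$: every connected component of $G-Z$ has to belong to $\Pi_i$ (for a non-empty hereditary class closed under disjoint unions this says that $G-Z\in\Pi_i$). A graph $G$ is $(s,c)$-unbreakable if $V(G)$ has no partition into three (possibly empty) sets $X,C,Y$ with no edge between $X$ and $Y$, $|C|\le c$, $|X|\ge s$ and $|Y|\ge s$. A parameterized problem is fixed-parameter tractable (FPT) on a set of instances $(G,k)$ if there are one algorithm, a computable function $f:\mathbb N\to\mathbb N$ and a constant $c$ such that the algorithm correctly decides every instance $(G,k)$ of the set in time $f(k)\,|G|^{c}$, where $|G|$ is the size of the encoding of $G$ by its adjacency matrix; it is FPT if it is so on all instances. It is non-uniformly FPT on the set if there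 is a constant $c$ such that for every $k$ there is an algorithm that correctly decides every instance of the set with parameter $k$ in time $O_k(|G|^{c})$. **Theorem.** Let $d\ge 0$ and let $\Pi_1,\dots,\Pi_d$ be hereditary graph classes such that, for every $i$, $\Pi_i$ Vertex Deletion is FPT. Let $s:\mathbb N\to\mathbb N$ be any function. If $s$ is computable, then $(\Pi_1,\dots,\Pi_d)$ Vertex Deletion is FPT on the instances $(G,k)$ in which $G$ is $(s(k),k)$-unbreakable. If $s$ is arbitrary, then $(\Pi_1,\dots,\Pi_d)$ Vertex Deletion is non-uniformly FPT on these instances. -/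

import Mathlib

/-!
# Vertex deletion to scattered graph classes

Graph classes, the vertex deletion problem, unbreakable graphs, and fixed-parameter tractability
over an explicit programming language with a step count.
-/

namespace Scattered

/-! ## Model of computation: WHILE programs over binary trees

Jones' textbook language WHILE. Data are binary trees, variables are numbered by `ℕ`, the only
operations are `nil`, `cons`, `hd`, `tl`, and the only test is whether a tree is `nil`. Every
elementary operation costs one unit. (Trees can be stored as shared pointers, so that running times
agree with those of multitape Turing machines up to a polynomial.) -/

/-- Binary trees, the data of the language. -/
inductive Data : Type
  | nil : Data
  | cons : Data → Data → Data

namespace Data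

/-- Left subtree (`nil` for `nil`). -/
def hd : Data → Data
  | nil => nil
  | cons a _ => a

/-- Right subtree (`nil` for `nil`). -/
def tl : Data → Data
  | nil => nil
  | cons _ b => b

/-- Number of nodes, leaves included; in particular it is positive. -/
def size : Data → ℕ
  | nil => 1
  | cons a b => a.size + b.size + 1

/-- A bit: `false` is `nil`, `true` is the one other tree of least size. -/
def ofBool : Bool → Data
  | false => nil
  | true => cons nil nil

/-- A list, as a right comb. -/
def ofList : List Data → Data
  | [] => nil
  | a :: l => cons a (ofList l)

/-- A natural number in unary. -/
def ofNat (k : ℕ) : Data := ofList (List.replicate k nil)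

end Data

/-- Values of the variables. -/
abbrev Store : Type := ℕ → Data

/-- Expressions. -/
inductive Expr : Type
  | var : ℕ → Expr
  | nil : Expr
  | cons : Expr → Expr → Expr
  | hd : Expr → Expr
  | tl : Expr → Expr

namespace Expr

/-- Value of an expression. -/
def eval (σ : Store) : Expr → Data
  | var i => σ i
  | nil => Data.nil
  | cons a b => Data.cons (a.eval σ) (b.eval σ)
  | hd a => (a.eval σ).hd
  | tl a => (a.eval σ).tl

/-- Time to evaluate an expression: one unit for each of its operations. -/
def cost : Expr → ℕ
  | var _ => 1
  | nil => 1
  | cons a b => a.cost + b.cost + 1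
  | hd a => a.cost + 1
  | tl a => a.cost + 1

end Expr

/-- Programs. -/
inductive Prog : Type
  | assign : ℕ → Expr → Prog
  | seq : Prog → Prog → Prog
  | ite : Expr → Prog → Prog → Prog
  | loop : Expr → Prog → Prog

/-- `Exec p σ τ t`: the program `p`, started in the store `σ`, halts in the store `τ` after
exactly `t` units of time. The guard of `ite` and of the while loop `loop` holds if its value is
not `nil`. -/
inductive Exec : Prog → Store → Store → ℕ → Prop
  | assign (i : ℕ) (e : Expr) (σ : Store) :
      Exec (.assign i e) σ (Function.update σ i (e.eval σ)) (e.cost + 1)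
  | seq {p q : Prog} {σ τ ρ : Store} {t u : ℕ} :
      Exec p σ τ t → Exec q τ ρ u → Exec (.seq p q) σ ρ (t + u + 1)
  | ite_true {e : Expr} {p q : Prog} {σ τ : Store} {t : ℕ} :
      e.eval σ ≠ Data.nil → Exec p σ τ t → Exec (.ite e p q) σ τ (e.cost + t + 1)
  | ite_false {e : Expr} {p q : Prog} {σ τ : Store} {t : ℕ} :
      e.eval σ = Data.nil → Exec q σ τ t → Exec (.ite e p q) σ τ (e.cost + t + 1)
  | loop_true {e : Expr} {p : Prog} {σ τ ρ : Store} {t u : ℕ} :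
      e.eval σ ≠ Data.nil → Exec p σ τ t → Exec (.loop e p) τ ρ u →
      Exec (.loop e p) σ ρ (e.cost + t + u + 1)
  | loop_false {e : Expr} {p : Prog} {σ : Store} :
      e.eval σ = Data.nil → Exec (.loop e p) σ σ (e.cost + 1)

/-- The initial store: the input is in variable `0`, all other variables are `nil`. -/
def initStore (x : Data) : Store := Function.update (fun _ => Data.nil) 0 x

/-- On input `x` the program `p` halts within `T` units of time, and it accepts (variable `0` is not
`nil` at the end) if and only if `b` holds. -/
def DecidesWithin (p : Prog) (x : Data) (b : Prop) (T : ℕ) : Prop :=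
  ∃ τ t, Exec p (initStore x) τ t ∧ t ≤ T ∧ (τ 0 ≠ Data.nil ↔ b)

/-! ## Parameterized graph problems -/

open Classical in
/-- A graph on `{0, …, n - 1}` is given by its adjacency matrix, as the list of its rows. -/
noncomputable def encodeGraph {n : ℕ} (G : SimpleGraph (Fin n)) : Data :=
  Data.ofList (List.ofFn fun i : Fin n =>
    Data.ofList (List.ofFn fun j : Fin n => Data.ofBool (decide (G.Adj i j))))

/-- The input `(G, k)`, with `k` in unary. -/
noncomputable def encodeInstance {n : ℕ} (G : SimpleGraph (Fin n)) (k : ℕ) : Data :=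
  Data.cons (encodeGraph G) (Data.ofNat k)

/-- A parameterized graph problem: a property of instances `(G, k)`, `k` being the parameter. -/
abbrev GraphProblem : Type := ∀ n : ℕ, SimpleGraph (Fin n) → ℕ → Prop

/-- The problem `L` is fixed-parameter tractable on the instances that satisfy `P`: one program
decides each of them in time `f(k) · |x| ^ c`, where `f` is computable and `|x|` is the size of the
encoded graph. Nothing is asked of the program on other instances. -/
def FPTOn (P L : GraphProblem) : Prop :=
  ∃ (p : Prog) (f : ℕ → ℕ) (c : ℕ), Computable f ∧
    ∀ (n : ℕ) (G : SimpleGraph (Fin n)) (k : ℕ), P n G k →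
      DecidesWithin p (encodeInstance G k) (L n G k) (f k * (encodeGraph G).size ^ c)

/-- The problem `L` is fixed-parameter tractable. -/
def FPT (L : GraphProblem) : Prop := FPTOn (fun _ _ _ => True) L

/-- The problem `L` is non-uniformly fixed-parameter tractable on the instances that satisfy `P`:
there are an exponent `c` and, for every `k`, a program that decides the instances with parameter
`k` in time `O(|x| ^ c)`, with a constant that may depend on `k`. -/
def NonuniformFPTOn (P L : GraphProblem) : Prop :=
  ∃ c : ℕ, ∀ k : ℕ, ∃ (p : Prog) (a : ℕ),
    ∀ (n : ℕ) (G : SimpleGraph (Fin n)), P n G k →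
      DecidesWithin p (encodeInstance G k) (L n G k) (a * (encodeGraph G).size ^ c)

/-! ## Graph classes and vertex deletion -/

/-- A class of finite graphs, closed under isomorphism. -/
structure GraphClass where
  /-- Membership of a finite graph in the class. -/
  Mem : ∀ {V : Type} [Finite V], SimpleGraph V → Prop
  /-- Membership depends on the isomorphism type only. -/
  mem_of_iso : ∀ {V W : Type} [Finite V] [Finite W] (G : SimpleGraph V) (H : SimpleGraph W),
    Nonempty (G ≃g H) → Mem G → Mem H

/-- A class is hereditary if it is closed under induced subgraphs. -/
def GraphClass.IsHereditary (Γ : GraphClass) : Prop :=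
  ∀ {V : Type} [Finite V] (G : SimpleGraph V) (S : Set V), Γ.Mem G → Γ.Mem (G.induce S)

/-- Every connected component of `G` is in at least one of the classes `Γ i`. -/
def ComponentsIn {ι : Type} (Γ : ι → GraphClass) {V : Type} [Finite V] (G : SimpleGraph V) : Prop :=
  ∀ C : G.ConnectedComponent, ∃ i, (Γ i).Mem (G.induce C.supp)

/-- The problem `(Γ₁, …, Γ_d)` Vertex Deletion: is there a set `Z` of at most `k` vertices such that
every connected component of `G - Z` is in at least one of the classes? -/
def VertexDeletion {ι : Type} (Γ : ι → GraphClass) : GraphProblem := fun n G k =>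
  ∃ Z : Finset (Fin n), Z.card ≤ k ∧ ComponentsIn Γ (G.induce {v | v ∉ Z})

/-- `G` is `(s, c)`-unbreakable: its vertex set has no partition into `X`, `C`, `Y` with no edge
between `X` and `Y`, with `|C| ≤ c`, and with `|X|, |Y| ≥ s`. -/
def IsUnbreakable {n : ℕ} (G : SimpleGraph (Fin n)) (s c : ℕ) : Prop :=
  ¬ ∃ X C Y : Finset (Fin n),
    X ∪ C ∪ Y = Finset.univ ∧ Disjoint X C ∧ Disjoint X Y ∧ Disjoint C Y ∧
    (∀ x ∈ X, ∀ y ∈ Y, ¬ G.Adj x y) ∧ C.card ≤ c ∧ s ≤ X.card ∧ s ≤ Y.card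

/-- The instances `(G, k)` with `G` an `(s k, k)`-unbreakable graph. -/
def UnbreakableInstances (s : ℕ → ℕ) : GraphProblem := fun _ G k => IsUnbreakable G (s k) k

end Scattered

/-! Let `Z` be a solution with at most `k` vertices in an `(s, k)`-unbreakable graph with more than
`k` vertices. A union of components of `G - Z` and the union of the others cannot both have `s`
vertices. Hence some component contains all but at most `3 * s` of the remaining vertices
(`exists_small_complement`). Let `i` be a class containing it, and assign `i` to every component
that lies in class `i`. The components assigned to other classes have at most `3 * s` vertices in
total, and none of them lies in class `i` (`exists_isSmallSolution`).

With `T = k + 3 * s`, the vertices that are deleted or not assigned to `i` form a modulator to class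
`i` of size at most `T`. Self-reduction with the algorithm for class `i` therefore finds some
modulator `M` of size at most `T` (`modulator_spec`). A component assigned to another class is not
in class `i`, so it meets `M`. Guess labels (deleted, or one of the `d` classes) for the vertices of
`M`, and then for the neighbours of vertices whose label is a class other than `i`. The correct
guesses label every component of another class completely, and they stop after at most `2 * T`
vertices (`exists_mem_branches`). All unlabelled vertices belong to class `i` or are deleted; the
algorithm for class `i` finds these last deletions with the budget that is left. This gives `(d + 1)
^ (2 * T)` branches, each checked with the given algorithms (`IsSmallSolution.search_eq_true`,
`vertexDeletion_of_check`).

For the running time, closure properties of `PolyTime` replace explicit programs. Fixed-parameter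
time becomes polynomial time because the measure of an `Input` includes an unencoded number that
bounds the number of branches and the parameter-dependent cost of the calls. Uniformity in `k` needs
a program for `s` with computable running time, obtained from Mathlib's codes for partial recursive
functions (`exists_run_of_computable`). For arbitrary `s` the value at the fixed `k` is a constant
in the program. -/

namespace Scattered

/-! ## Clean runs -/

namespace Expr

/-- Renaming of the variables `i ↦ i + m`. -/
def shift (m : ℕ) : Expr → Expr
  | var i => var (i + m)
  | nil => nil
  | cons a b => cons (a.shift m) (b.shift m)
  | hd a => hd (a.shift m)
  | tl a => tl (a.shift m)

theorem eval_shift {m : ℕ} {σ σ' : Store} (h : ∀ i, σ' (i + m) = σ i) (e : Expr) :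
    (e.shift m).eval σ' = e.eval σ := by
  induction e <;> simp_all [shift, eval]

@[simp] theorem cost_shift (m : ℕ) (e : Expr) : (e.shift m).cost = e.cost := by
  induction e <;> simp_all [shift, cost]

end Expr

namespace Prog

/-- Renaming of the variables `i ↦ i + m`. -/
def shift (m : ℕ) : Prog → Prog
  | assign i e => assign (i + m) (e.shift m)
  | seq p q => seq (p.shift m) (q.shift m)
  | ite e p q => ite (e.shift m) (p.shift m) (q.shift m)
  | loop e p => loop (e.shift m) (p.shift m)

/-- All variables that the program assigns to are less than this number. -/
def bound : Prog → ℕ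
  | assign i _ => i + 1
  | seq p q => max p.bound q.bound
  | ite _ p q => max p.bound q.bound
  | loop _ p => p.bound

end Prog

/-- The first `m` variables survive the run of a renamed program, so they can hold saved values
while it runs as a subroutine. -/
theorem Exec.shift {p : Prog} {σ τ : Store} {t : ℕ} (h : Exec p σ τ t) (m : ℕ) :
    ∀ σ' : Store, (∀ i, σ' (i + m) = σ i) →
      ∃ τ' : Store, Exec (p.shift m) σ' τ' t ∧ (∀ i, τ' (i + m) = τ i) ∧
        ∀ i < m, τ' i = σ' i := by
  induction h with
  | assign i e σ =>
    intro σ' hσ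
    refine ⟨_, by simpa [Prog.shift] using Exec.assign (i + m) (e.shift m) σ', fun j => ?_, fun j hj => ?_⟩
    · rw [Expr.eval_shift hσ]
      by_cases hji : j = i
      · subst hji; simp
      · rw [Function.update_of_ne (by omega), Function.update_of_ne hji, hσ]
    · rw [Function.update_of_ne (by omega)]
  | seq _ _ ih₁ ih₂ =>
    intro σ' hσ
    obtain ⟨τ', h₁, h₂, h₃⟩ := ih₁ σ' hσ
    obtain ⟨ρ', h₄, h₅, h₆⟩ := ih₂ τ' h₂
    exact ⟨ρ', h₁.seq h₄, h₅, fun i hi => by rw [h₆ i hi, h₃ i hi]⟩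
  | @ite_true e p q σ τ t hg _ ih =>
    intro σ' hσ
    obtain ⟨τ', h₁, h₂, h₃⟩ := ih σ' hσ
    have hg' : (e.shift m).eval σ' ≠ Data.nil := by rwa [Expr.eval_shift hσ]
    refine ⟨τ', ?_, h₂, h₃⟩
    simpa [Prog.shift] using Exec.ite_true (q := q.shift m) hg' h₁
  | @ite_false e p q σ τ t hg _ ih =>
    intro σ' hσ
    obtain ⟨τ', h₁, h₂, h₃⟩ := ih σ' hσ
    have hg' : (e.shift m).eval σ' = Data.nil := by rwa [Expr.eval_shift hσ]
    refine ⟨τ', ?_, h₂, h₃⟩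
    simpa [Prog.shift] using Exec.ite_false (p := p.shift m) hg' h₁
  | @loop_true e p σ τ ρ t u hg _ _ ih₁ ih₂ =>
    intro σ' hσ
    obtain ⟨τ', h₁, h₂, h₃⟩ := ih₁ σ' hσ
    obtain ⟨ρ', h₄, h₅, h₆⟩ := ih₂ τ' h₂
    have hg' : (e.shift m).eval σ' ≠ Data.nil := by rwa [Expr.eval_shift hσ]
    refine ⟨ρ', ?_, h₅, fun i hi => by rw [h₆ i hi, h₃ i hi]⟩
    simpa [Prog.shift] using Exec.loop_true hg' h₁ h₄
  | @loop_false e p σ hg =>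
    intro σ' hσ
    have hg' : (e.shift m).eval σ' = Data.nil := by rwa [Expr.eval_shift hσ]
    exact ⟨σ', by simpa [Prog.shift] using Exec.loop_false (p := p.shift m) hg', hσ, fun _ _ => rfl⟩

theorem Exec.eq_of_bound_le {p : Prog} {σ τ : Store} {t : ℕ} (h : Exec p σ τ t) :
    ∀ i, p.bound ≤ i → τ i = σ i := by
  induction h with
  | assign i e σ =>
    intro j hj
    simp only [Prog.bound] at hj
    rw [Function.update_of_ne (by omega)]
  | seq _ _ ih₁ ih₂ =>
    intro j hj
    simp only [Prog.bound, max_le_iff] at hj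
    rw [ih₂ j hj.2, ih₁ j hj.1]
  | ite_true _ _ ih =>
    intro j hj
    simp only [Prog.bound, max_le_iff] at hj
    exact ih j hj.1
  | ite_false _ _ ih =>
    intro j hj
    simp only [Prog.bound, max_le_iff] at hj
    exact ih j hj.2
  | loop_true _ _ _ ih₁ ih₂ =>
    intro j hj
    rw [ih₂ j hj, ih₁ j (by simpa [Prog.bound] using hj)]
  | loop_false _ => intros; rfl

/-- `p` turns the input `x` into the output `y` within `t` units of time, and all variables but `0`
are `nil` at the end, as they are at the beginning. -/
def Run (p : Prog) (x y : Data) (t : ℕ) : Prop :=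
  ∃ u ≤ t, Exec p (initStore x) (initStore y) u

theorem initStore_zero (x : Data) : initStore x 0 = x := by simp [initStore]

theorem initStore_succ (x : Data) (i : ℕ) : initStore x (i + 1) = Data.nil := by simp [initStore]

theorem update_initStore (x y : Data) : Function.update (initStore x) 0 y = initStore y := by
  simp [initStore]

namespace Run

theorem mono {p : Prog} {x y : Data} {t u : ℕ} (h : Run p x y t) (htu : t ≤ u) : Run p x y u := by
  obtain ⟨v, hv, h⟩ := h
  exact ⟨v, hv.trans htu, h⟩

theorem assign (e : Expr) (x : Data) :
    Run (.assign 0 e) x (e.eval (initStore x)) (e.cost + 1) :=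
  ⟨_, le_rfl, by simpa [update_initStore] using Exec.assign 0 e (initStore x)⟩

theorem seq {p q : Prog} {x y z : Data} {t u : ℕ} (h₁ : Run p x y t) (h₂ : Run q y z u) :
    Run (.seq p q) x z (t + u + 1) := by
  obtain ⟨t', ht, h₁⟩ := h₁
  obtain ⟨u', hu, h₂⟩ := h₂
  exact ⟨_, by omega, h₁.seq h₂⟩

theorem ite_true {e : Expr} {p q : Prog} {x y : Data} {t : ℕ}
    (hg : e.eval (initStore x) ≠ Data.nil) (h : Run p x y t) :
    Run (.ite e p q) x y (e.cost + t + 1) := by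
  obtain ⟨t', ht, h⟩ := h
  exact ⟨_, by omega, h.ite_true hg⟩

theorem ite_false {e : Expr} {p q : Prog} {x y : Data} {t : ℕ}
    (hg : e.eval (initStore x) = Data.nil) (h : Run q x y t) :
    Run (.ite e p q) x y (e.cost + t + 1) := by
  obtain ⟨t', ht, h⟩ := h
  exact ⟨_, by omega, h.ite_false hg⟩

theorem loop_true {e : Expr} {p : Prog} {x y z : Data} {t u : ℕ}
    (hg : e.eval (initStore x) ≠ Data.nil) (h₁ : Run p x y t) (h₂ : Run (.loop e p) y z u) :
    Run (.loop e p) x z (e.cost + t + u + 1) := by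
  obtain ⟨t', ht, h₁⟩ := h₁
  obtain ⟨u', hu, h₂⟩ := h₂
  exact ⟨_, by omega, h₁.loop_true hg h₂⟩

theorem loop_false {e : Expr} {p : Prog} {x : Data} (hg : e.eval (initStore x) = Data.nil) :
    Run (.loop e p) x x (e.cost + 1) :=
  ⟨_, le_rfl, .loop_false hg⟩

end Run

namespace Prog

/-- Runs `p` and `q` on the same input and pairs the outputs. -/
def pair (p q : Prog) : Prog :=
  seq (assign 2 (.var 0)) <| seq (p.shift 2) <| seq (assign 1 (.var 2)) <|
  seq (assign 2 (.var 0)) <| seq (q.shift 2) <| seq (assign 0 (.cons (.var 1) (.var 2))) <|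
  seq (assign 1 .nil) (assign 2 .nil)

/-- Runs `p` or `q`, according to the output of `c`. -/
def cond (c p q : Prog) : Prog :=
  seq (c.pair (assign 0 (.var 0))) <|
  ite (.hd (.var 0)) (seq (assign 0 (.tl (.var 0))) p) (seq (assign 0 (.tl (.var 0))) q)

/-- Sets the variables `1, …, m` to `nil`. -/
def clear : ℕ → Prog
  | 0 => assign 1 .nil
  | m + 1 => seq (clear m) (assign (m + 1) .nil)

/-- Decides what `p` decides, with the answer `Data.ofBool b` and all other variables `nil`. -/
def clean (p : Prog) : Prog :=
  seq p <| seq (ite (.var 0) (assign 0 (.cons .nil .nil)) (assign 0 .nil)) (clear p.bound)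

end Prog

/-- Variable `0` keeps the input and variable `1` the first output, while both programs work from
variable `2` on. The second finds its other variables `nil` because the first run is clean. Additive
constants here and below are rounded up. -/
theorem Run.pair {p q : Prog} {x y z : Data} {t u : ℕ} (h₁ : Run p x y t) (h₂ : Run q x z u) :
    Run (p.pair q) x (.cons y z) (t + u + 25) := by
  obtain ⟨t', ht, h₁⟩ := h₁
  obtain ⟨u', hu, h₂⟩ := h₂
  obtain ⟨τ₁, e₁, hi₁, lo₁⟩ := h₁.shift 2 (Function.update (initStore x) 2 x) (by
    intro i
    rcases i with _ | i
    · simp [initStore_zero]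
    · rw [Function.update_of_ne (by omega), initStore_succ, initStore_succ])
  obtain ⟨τ₂, e₂, hi₂, lo₂⟩ := h₂.shift 2
    (Function.update (Function.update τ₁ 1 y) 2 x) (by
    intro i
    rcases i with _ | i
    · simp [initStore_zero]
    · rw [Function.update_of_ne (by omega), Function.update_of_ne (by omega), hi₁,
        initStore_succ, initStore_succ])
  have a₁ := Exec.assign 2 (.var 0) (initStore x)
  have a₂ := Exec.assign 1 (.var 2) τ₁
  have a₃ := Exec.assign 2 (.var 0) (Function.update τ₁ 1 y)
  have a₄ := Exec.assign 0 (.cons (.var 1) (.var 2)) τ₂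
  have hy : τ₁ 2 = y := by simpa [initStore_zero] using hi₁ 0
  have hz : τ₂ 2 = z := by simpa [initStore_zero] using hi₂ 0
  have hx : τ₁ 0 = x := by simpa [initStore_zero] using lo₁ 0 (by omega)
  have hy' : τ₂ 1 = y := by simpa using lo₂ 1 (by omega)
  simp only [Expr.eval, initStore_zero, hy, hz, hy', Expr.cost] at a₁ a₂ a₃ a₄
  rw [Function.update_of_ne (by omega), hx] at a₃
  have a₅ := Exec.assign 1 .nil (Function.update τ₂ 0 (.cons y z))
  have a₆ := Exec.assign 2 .nil (Function.update (Function.update τ₂ 0 (.cons y z)) 1 .nil)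
  have key := a₁.seq (e₁.seq (a₂.seq (a₃.seq (e₂.seq (a₄.seq (a₅.seq a₆))))))
  refine ⟨?_, ?_, ?_⟩
  rotate_left 2
  · convert key using 1
    · rfl
    funext i
    rcases i with _ | _ | _ | i
    · simp [initStore_zero]
    · simp [initStore_succ]
    · simp [initStore_succ, Expr.eval]
    · rw [initStore_succ, Function.update_of_ne (by omega), Function.update_of_ne (by omega),
        Function.update_of_ne (by omega), hi₂, initStore_succ]
  · simp only [Expr.cost]
    omega

theorem Run.cond {c p q : Prog} {x b y : Data} {t u : ℕ} (hc : Run c x b t)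
    (hp : b ≠ .nil → Run p x y u) (hq : b = .nil → Run q x y u) :
    Run (c.cond p q) x y (t + u + 40) := by
  have h₁ := hc.pair (Run.assign (.var 0) x)
  have h₂ := Run.assign (.tl (.var 0)) (.cons b x)
  simp only [Expr.eval, initStore_zero, Data.tl, Expr.cost] at h₁ h₂
  by_cases hb : b = .nil
  · exact (h₁.seq (Run.ite_false (by simpa [Expr.eval, initStore_zero, Data.hd] using hb)
      (h₂.seq (hq hb)))).mono (by simp only [Expr.cost]; omega)
  · exact (h₁.seq (Run.ite_true (by simpa [Expr.eval, initStore_zero, Data.hd] using hb)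
      (h₂.seq (hp hb)))).mono (by simp only [Expr.cost]; omega)

theorem exec_clear (m : ℕ) (σ : Store) :
    ∃ τ, Exec (Prog.clear m) σ τ (3 * m + 2) ∧
      ∀ i, τ i = if 1 ≤ i ∧ i ≤ max m 1 then Data.nil else σ i := by
  induction m with
  | zero =>
    refine ⟨_, .assign 1 .nil σ, fun i => ?_⟩
    by_cases h : i = 1
    · subst h; simp [Expr.eval]
    · rw [Function.update_of_ne h, if_neg (by omega)]
  | succ m ih =>
    obtain ⟨τ, h, hτ⟩ := ih
    refine ⟨Function.update τ (m + 1) .nil, ?_, fun i => ?_⟩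
    · have := h.seq (.assign (m + 1) .nil τ)
      simp only [Expr.cost, Expr.eval] at this
      convert this using 1
      · rfl
      · omega
    · by_cases h : i = m + 1
      · subst h; simp
      · rw [Function.update_of_ne h, hτ]
        congr 1
        simp only [eq_iff_iff]
        omega

theorem Run.clean {p : Prog} {x : Data} {b : Bool} {t : ℕ} (h : DecidesWithin p x (b = true) t) :
    Run p.clean x (Data.ofBool b) (t + 3 * p.bound + 15) := by
  obtain ⟨τ, t', hp, ht, hb⟩ := h
  have h₁ : ∃ u ≤ 6, Exec (.ite (.var 0) (.assign 0 (.cons .nil .nil)) (.assign 0 .nil)) τ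
      (Function.update τ 0 (Data.ofBool b)) u := by
    by_cases h0 : τ 0 = .nil
    · have : b = false := by simpa [h0] using hb
      subst this
      exact ⟨_, by simp [Expr.cost], .ite_false h0 (.assign 0 .nil τ)⟩
    · have : b = true := by simpa [h0] using hb
      subst this
      exact ⟨_, by simp [Expr.cost], .ite_true h0 (.assign 0 (.cons .nil .nil) τ)⟩
  obtain ⟨u, hu, h₁⟩ := h₁
  obtain ⟨ρ, h₂, hρ⟩ := exec_clear p.bound (Function.update τ 0 (Data.ofBool b))
  refine ⟨?_, ?_, ?_⟩
  rotate_left 2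
  · convert hp.seq (h₁.seq h₂) using 1
    · rfl
    funext i
    rw [hρ]
    rcases i with _ | i
    · simp [initStore_zero]
    · rw [initStore_succ]
      split_ifs with hi
      · rfl
      · rw [Function.update_of_ne (by omega), hp.eq_of_bound_le _ (by omega), initStore_succ]
  · omega

theorem Run.decidesWithin {p : Prog} {x : Data} {b : Bool} {t : ℕ}
    (h : Run p x (Data.ofBool b) t) : DecidesWithin p x (b = true) t := by
  obtain ⟨u, hu, h⟩ := h
  refine ⟨_, _, h, hu, ?_⟩
  cases b <;> simp [initStore_zero, Data.ofBool]

/-! ## Encodings and polynomial time -/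

/-- A type with an encoding by trees and a measure of size. The measure may exceed the size of the
encoding, so that running times can be bounded in terms of data that are not encoded. -/
class Enc (α : Type) where
  /-- The encoding. -/
  enc : α → Data
  /-- The measure. -/
  mu : α → ℕ

namespace Enc

instance : Enc Bool := ⟨Data.ofBool, fun b => (Data.ofBool b).size⟩

instance : Enc ℕ := ⟨Data.ofNat, fun n => 2 * n + 1⟩

instance : Enc Unit := ⟨fun _ => .nil, fun _ => 1⟩

instance {α β : Type} [Enc α] [Enc β] : Enc (α × β) :=
  ⟨fun x => .cons (enc x.1) (enc x.2), fun x => mu x.1 + mu x.2 + 1⟩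

instance {α : Type} [Enc α] : Enc (List α) :=
  ⟨fun l => Data.ofList (l.map enc), fun l => (l.map fun a => mu a + 1).sum + 1⟩

end Enc

open Enc

section Lemmas

variable {α β γ σ : Type} [Enc α] [Enc β] [Enc γ] [Enc σ]

@[simp] theorem enc_mk (a : α) (b : β) : enc (a, b) = .cons (enc a) (enc b) := rfl
@[simp] theorem mu_mk (a : α) (b : β) : mu (a, b) = mu a + mu b + 1 := rfl
@[simp] theorem enc_list_nil : enc ([] : List α) = .nil := rfl
@[simp] theorem enc_list_cons (a : α) (l : List α) : enc (a :: l) = .cons (enc a) (enc l) := rfl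
@[simp] theorem mu_list_nil : mu ([] : List α) = 1 := rfl
@[simp] theorem mu_list_cons (a : α) (l : List α) : mu (a :: l) = mu a + mu l + 1 := by
  change (List.map _ (a :: l)).sum + 1 = mu a + ((List.map _ l).sum + 1) + 1
  simp only [List.map_cons, List.sum_cons]; omega
@[simp] theorem enc_zero : enc (0 : ℕ) = .nil := rfl
@[simp] theorem enc_succ (n : ℕ) : enc (n + 1) = .cons .nil (enc n) := by
  simp [enc, Data.ofNat, List.replicate_succ, Data.ofList]
@[simp] theorem mu_nat (n : ℕ) : mu n = 2 * n + 1 := rfl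
@[simp] theorem enc_false : enc false = .nil := rfl
@[simp] theorem enc_true : enc true = .cons .nil .nil := rfl
theorem mu_bool_le (b : Bool) : mu b ≤ 3 := by cases b <;> decide

theorem length_lt_mu (l : List α) : l.length < mu l := by
  induction l with
  | nil => simp
  | cons a l ih => simp only [List.length_cons, mu_list_cons]; omega

theorem mu_lt_of_mem {a : α} {l : List α} (h : a ∈ l) : mu a < mu l := by
  induction l with
  | nil => simp at h
  | cons b l ih =>
    rcases List.mem_cons.1 h with rfl | h
    · simp only [mu_list_cons]; omega
    · have := ih h
      simp only [mu_list_cons]; omega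

theorem mu_list_le {l : List α} {m : ℕ} (h : ∀ a ∈ l, mu a ≤ m) :
    mu l ≤ l.length * (m + 1) + 1 := by
  induction l with
  | nil => simp
  | cons a l ih =>
    have h₁ := h a (by simp)
    have h₂ := ih fun b hb => h b (by simp [hb])
    simp only [mu_list_cons, List.length_cons]
    nlinarith

theorem mu_replicate_unit (n : ℕ) : mu (List.replicate n ()) = 2 * n + 1 := by
  induction n with
  | zero => rfl
  | succ n ih =>
    rw [List.replicate_succ, mu_list_cons, ih]
    change 1 + _ + 1 = _
    omega

theorem enc_replicate_unit (n : ℕ) : enc (List.replicate n ()) = enc n := by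
  simp only [enc, List.map_replicate, Data.ofNat]

/-! ### Polynomial bounds and polynomial-time functions. -/

/-- A function bounded by a polynomial in the measure. -/
def PolyBdd (f : α → ℕ) : Prop := ∃ c, ∀ a, f a ≤ (mu a + 2) ^ c

namespace PolyBdd

theorem mono {f g : α → ℕ} (hg : PolyBdd g) (h : ∀ a, f a ≤ g a) : PolyBdd f := by
  obtain ⟨c, hc⟩ := hg
  exact ⟨c, fun a => (h a).trans (hc a)⟩

theorem measure : PolyBdd (fun a : α => mu a) := ⟨1, fun a => by simp⟩

/-- The base `mu a + 2` is at least two, so constants can be absorbed into the exponent. -/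
theorem const (n : ℕ) : PolyBdd (fun _ : α => n) :=
  ⟨n, fun a => (Nat.lt_two_pow_self.le).trans (Nat.pow_le_pow_left (by omega) n)⟩

theorem mul {f g : α → ℕ} (hf : PolyBdd f) (hg : PolyBdd g) : PolyBdd (fun a => f a * g a) := by
  obtain ⟨c, hc⟩ := hf
  obtain ⟨d, hd⟩ := hg
  exact ⟨c + d, fun a => by rw [pow_add]; exact Nat.mul_le_mul (hc a) (hd a)⟩

theorem add {f g : α → ℕ} (hf : PolyBdd f) (hg : PolyBdd g) : PolyBdd (fun a => f a + g a) := by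
  obtain ⟨c, hc⟩ := hf
  obtain ⟨d, hd⟩ := hg
  refine ⟨max c d + 1, fun a => ?_⟩
  have h₁ := (hc a).trans (Nat.pow_le_pow_right (by omega) (le_max_left c d))
  have h₂ := (hd a).trans (Nat.pow_le_pow_right (by omega) (le_max_right c d))
  rw [pow_succ]
  nlinarith [Nat.zero_le (mu a * (mu a + 2) ^ max c d)]

theorem pow {f : α → ℕ} (hf : PolyBdd f) (n : ℕ) : PolyBdd (fun a => f a ^ n) := by
  obtain ⟨c, hc⟩ := hf
  exact ⟨c * n, fun a => by rw [pow_mul]; exact Nat.pow_le_pow_left (hc a) n⟩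

theorem comp {f : β → ℕ} {g : α → β} (hf : PolyBdd f) (hg : PolyBdd fun a => mu (g a)) :
    PolyBdd (fun a => f (g a)) := by
  obtain ⟨c, hc⟩ := hf
  exact ((hg.add (const 2)).pow c).mono fun a => hc (g a)

end PolyBdd

/-- `f` is computed by a program in time polynomial in the measure, and its values have polynomial
measure. -/
def PolyTime (f : α → β) : Prop :=
  ∃ p : Prog, ∃ T : α → ℕ, PolyBdd T ∧ (∀ a, Run p (enc a) (enc (f a)) (T a)) ∧
    PolyBdd fun a => mu (f a)

namespace PolyTime

theorem polyBdd {f : α → β} (h : PolyTime f) : PolyBdd fun a => mu (f a) :=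
  h.choose_spec.choose_spec.2.2

theorem of_eq {f g : α → β} (h : PolyTime f) (e : ∀ a, f a = g a) : PolyTime g :=
  (funext e : f = g) ▸ h

theorem of_expr (e : Expr) {f : α → β} (h : ∀ a, e.eval (initStore (enc a)) = enc (f a))
    (hb : PolyBdd fun a => mu (f a)) : PolyTime f :=
  ⟨.assign 0 e, fun _ => e.cost + 1, .const _, fun a => h a ▸ Run.assign e (enc a), hb⟩

theorem of_enc_eq {f : α → β} (h : ∀ a, enc (f a) = enc a) (hb : ∀ a, mu (f a) ≤ mu a) :
    PolyTime f :=
  of_expr (.var 0) (fun a => by simp [Expr.eval, initStore_zero, h]) (PolyBdd.measure.mono hb)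

theorem id : PolyTime fun a : α => a := of_enc_eq (fun _ => rfl) fun _ => le_rfl

theorem comp {g : β → γ} {f : α → β} (hg : PolyTime g) (hf : PolyTime f) :
    PolyTime fun a => g (f a) := by
  obtain ⟨p, T, hT, hp, hb⟩ := hg
  obtain ⟨q, U, hU, hq, hc⟩ := hf
  exact ⟨q.seq p, fun a => U a + T (f a) + 1, (hU.add (hT.comp hc)).add (.const 1),
    fun a => (hq a).seq (hp (f a)), hb.comp hc⟩

theorem pair {f : α → β} {g : α → γ} (hf : PolyTime f) (hg : PolyTime g) :
    PolyTime fun a => (f a, g a) := by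
  obtain ⟨p, T, hT, hp, hb⟩ := hf
  obtain ⟨q, U, hU, hq, hc⟩ := hg
  exact ⟨p.pair q, fun a => T a + U a + 25, (hT.add hU).add (.const 25),
    fun a => (hp a).pair (hq a), (hb.add hc).add (.const 1)⟩

theorem fst {f : α → β × γ} (hf : PolyTime f) : PolyTime fun a => (f a).1 :=
  comp (g := Prod.fst) (of_expr (.hd (.var 0))
    (fun a => by simp [Expr.eval, initStore_zero, enc, Data.hd])
    (PolyBdd.measure.mono fun a => by change _ ≤ mu a.1 + mu a.2 + 1; omega)) hf

theorem snd {f : α → β × γ} (hf : PolyTime f) : PolyTime fun a => (f a).2 :=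
  comp (g := Prod.snd) (of_expr (.tl (.var 0))
    (fun a => by simp [Expr.eval, initStore_zero, enc, Data.tl])
    (PolyBdd.measure.mono fun a => by change _ ≤ mu a.1 + mu a.2 + 1; omega)) hf

end PolyTime

end Lemmas

/-- An expression whose value is the given tree. -/
def Data.toExpr : Data → Expr
  | nil => .nil
  | cons a b => .cons a.toExpr b.toExpr

theorem Data.eval_toExpr (x : Data) (σ : Store) : x.toExpr.eval σ = x := by
  induction x <;> simp_all [toExpr, Expr.eval]

namespace PolyTime

variable {α β γ σ : Type} [Enc α] [Enc β] [Enc γ] [Enc σ]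

theorem const (b : β) : PolyTime fun _ : α => b :=
  of_expr (enc b).toExpr (fun _ => Data.eval_toExpr _ _) (.const _)

theorem cond {c : α → Bool} {f g : α → β} (hc : PolyTime c) (hf : PolyTime f) (hg : PolyTime g) :
    PolyTime fun a => if c a then f a else g a := by
  obtain ⟨p, T, hT, hp, -⟩ := hc
  obtain ⟨q, U, hU, hq, hb⟩ := hf
  obtain ⟨r, W, hW, hr, hb'⟩ := hg
  refine ⟨p.cond q r, fun a => T a + (U a + W a) + 40, (hT.add (hU.add hW)).add (.const 40),
    fun a => (hp a).cond (fun h => ?_) (fun h => ?_), (hb.add hb').mono fun a => ?_⟩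
  · have : c a = true := by cases hca : c a <;> simp_all
    simpa [this] using (hq a).mono (Nat.le_add_right _ _)
  · have : c a = false := by cases hca : c a <;> simp_all
    simpa [this] using (hr a).mono (Nat.le_add_left _ _)
  · dsimp only
    split_ifs <;> omega

theorem list_cons {f : α → β} {g : α → List β} (hf : PolyTime f) (hg : PolyTime g) :
    PolyTime fun a => f a :: g a :=
  comp (g := fun x : β × List β => x.1 :: x.2)
    (of_enc_eq (fun _ => rfl) fun x => by rw [mu_list_cons]; rfl) (hf.pair hg)

theorem list_tail {f : α → List β} (hf : PolyTime f) : PolyTime fun a => (f a).tail :=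
  comp (g := List.tail) (of_expr (.tl (.var 0))
    (fun l => by cases l <;> simp [Expr.eval, initStore_zero, Data.tl])
    (PolyBdd.measure.mono fun l => by cases l <;> simp; omega)) hf

/-- On the empty list `hd` returns `nil`, so the default has to be encoded by `nil`. -/
theorem list_headD {f : α → List β} {b : β} (hb : enc b = .nil) (hf : PolyTime f) :
    PolyTime fun a => (f a).headD b :=
  comp (g := fun l => l.headD b) (of_expr (.hd (.var 0))
    (fun l => by cases l <;> simp [Expr.eval, initStore_zero, Data.hd, hb])
    ((PolyBdd.measure.add (.const (mu b))).mono fun l => by cases l <;> simp; omega)) hf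

/-- A non-empty list is encoded like the pair of its head and tail. Pairing the input with the
recomputed list therefore already gives the argument of the second branch. -/
theorem list_cases {f : α → List β} {g : α → γ} {h : α → β → List β → γ} (hf : PolyTime f)
    (hg : PolyTime g) (hh : PolyTime fun x : α × β × List β => h x.1 x.2.1 x.2.2) :
    PolyTime fun a => match f a with
      | [] => g a
      | b :: l => h a b l := by
  obtain ⟨p, T, hT, hp, hb⟩ := hf
  obtain ⟨q, U, hU, hq, hb'⟩ := hg
  obtain ⟨r, W, hW, hr, hb''⟩ := hh
  have hm : ∀ {a b l}, f a = b :: l → mu (a, b, l) + 2 ≤ mu a + mu (f a) + 3 := by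
    intro a b l h
    rw [h]; simp only [mu_mk, mu_list_cons]; omega
  obtain ⟨w, hw⟩ := hW
  obtain ⟨v, hv⟩ := hb''
  have hW' := ((PolyBdd.measure.add hb).add (.const 3)).pow w
  have hV' := ((PolyBdd.measure.add hb).add (.const 3)).pow v
  refine ⟨p.cond (.seq (Prog.pair (.assign 0 (.var 0)) p) r) q, fun a => T a + (T a + 2 + 25 +
      (mu a + mu (f a) + 3) ^ w + 1 + U a) + 40, ?_, fun a => ?_,
      ((hV'.add hb').mono fun a => ?_)⟩
  · exact (hT.add ((((((hT.add (.const 2)).add (.const 25)).add hW')).add (.const 1)).add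
      hU)).add (.const 40)
  · refine (hp a).cond (fun h => ?_) (fun h => ?_)
    · dsimp only
      cases hfa : f a with
      | nil => simp [hfa] at h
      | cons b l =>
        have h₁ := (Run.assign (.var 0) (enc a)).pair (hp a)
        have h₂ := (hr (a, b, l)).mono ((hw _).trans (Nat.pow_le_pow_left (hm hfa) w))
        simp only [Expr.eval, initStore_zero, Expr.cost, hfa] at h₁ h₂
        exact (h₁.seq h₂).mono (by omega)
    · dsimp only
      cases hfa : f a with
      | nil => exact (hq a).mono (by omega)
      | cons b l => simp [hfa] at h
  · dsimp only
    cases hfa : f a with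
    | nil => exact Nat.le_add_left _ _
    | cons b l =>
      have h₂ := (hv (a, b, l)).trans (Nat.pow_le_pow_left (hm hfa) v)
      rw [hfa] at h₂
      exact h₂.trans (Nat.le_add_right _ _)

end PolyTime

/-! ### Loops over lists -/

/-- One round of a loop over a list, on `((b :: l), (a, s))`. -/
def Prog.foldBody (p : Prog) : Prog :=
  .pair (.assign 0 (.tl (.hd (.var 0)))) <| .pair (.assign 0 (.hd (.tl (.var 0)))) <|
    .seq (.assign 0 (.cons (.hd (.tl (.var 0))) (.cons (.tl (.tl (.var 0))) (.hd (.hd (.var 0)))))) p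

/-- The store holds the remaining list, the fixed argument and the accumulator. The time bound for a
round is only asked for accumulators that actually occur, since these are the only ones with
controlled measure. -/
theorem Run.fold {α β σ : Type} [Enc α] [Enc β] [Enc σ] {p : Prog} {a : α} {h : σ → β → σ} {S : ℕ}
    (l : List β) (s : σ)
    (hp : ∀ l₁ b l₂, l = l₁ ++ b :: l₂ →
      Run p (enc (a, l₁.foldl h s, b)) (enc (h (l₁.foldl h s) b)) S) :
    Run (.loop (.hd (.var 0)) p.foldBody) (enc (l, a, s)) (enc (([] : List β), a, l.foldl h s))
      (l.length * (S + 80) + 3) := by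
  induction l generalizing s with
  | nil => exact (Run.loop_false (by simp [Expr.eval, initStore_zero, Data.hd])).mono (by simp [Expr.cost])
  | cons b l ih =>
    have h₁ := Run.assign (.tl (.hd (.var 0))) (enc (b :: l, a, s))
    have h₂ := Run.assign (.hd (.tl (.var 0))) (enc (b :: l, a, s))
    have h₃ := Run.assign (.cons (.hd (.tl (.var 0))) (.cons (.tl (.tl (.var 0))) (.hd (.hd (.var 0)))))
      (enc (b :: l, a, s))
    have h₄ := hp [] b l rfl
    have h₅ := ih (h s b) fun l₁ c l₂ e => by simpa using hp (b :: l₁) c l₂ (by simp [e])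
    simp only [Expr.eval, initStore_zero, Data.hd, Data.tl, Expr.cost, enc_mk, enc_list_cons,
      List.foldl_nil, List.foldl_cons] at h₁ h₂ h₃ h₄ h₅ ⊢
    have h₆ := h₁.pair (h₂.pair (h₃.seq h₄))
    refine (Run.loop_true (by simp [Expr.eval, initStore_zero, Data.hd]) h₆ h₅).mono ?_
    simp only [Expr.cost, List.length_cons]
    ring_nf
    omega

namespace PolyTime

variable {α β γ σ : Type} [Enc α] [Enc β] [Enc γ] [Enc σ]

/-- Iterating a polynomial-time step may blow up the accumulator, so a polynomial bound `D` for all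
intermediate values is a hypothesis. -/
theorem foldl {f : α → List β} {g : α → σ} {h : α → σ → β → σ} (hf : PolyTime f) (hg : PolyTime g)
    (hh : PolyTime fun x : α × σ × β => h x.1 x.2.1 x.2.2) {D : α → ℕ} (hD : PolyBdd D)
    (hb : ∀ a l, l <+: f a → mu (l.foldl (h a) (g a)) ≤ D a) :
    PolyTime fun a => (f a).foldl (h a) (g a) := by
  obtain ⟨p, T, hT, hp, hfb⟩ := hf
  obtain ⟨q, U, hU, hq, hgb⟩ := hg
  obtain ⟨r, W, ⟨w, hw⟩, hr, -⟩ := hh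
  have hS := (((PolyBdd.measure.add hD).add hfb).add (.const 4)).pow w
  refine ⟨.seq (.pair p (.pair (.assign 0 (.var 0)) q)) (.seq (.loop (.hd (.var 0)) r.foldBody)
    (.assign 0 (.tl (.tl (.var 0))))), fun a => T a + (U a + 27) + 25 +
      (mu (f a) * ((mu a + D a + mu (f a) + 4) ^ w + 80) + 3 + 4 + 1) + 1, ?_, fun a => ?_,
      hD.mono fun a => hb a _ ⟨[], List.append_nil _⟩⟩
  · exact (((hT.add (hU.add (.const 27))).add (.const 25)).add
      ((((hfb.mul (hS.add (.const 80))).add (.const 3)).add (.const 4)).add (.const 1))).add (.const 1)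
  · have h₁ := (hp a).pair ((Run.assign (.var 0) (enc a)).pair (hq a))
    have h₂ := Run.fold (p := r) (a := a) (h := h a) (S := (mu a + D a + mu (f a) + 4) ^ w)
      (f a) (g a) (by
        intro l₁ b l₂ e
        refine (hr (a, l₁.foldl (h a) (g a), b)).mono ((hw _).trans (Nat.pow_le_pow_left ?_ w))
        have := hb a l₁ ⟨b :: l₂, e.symm⟩
        have := mu_lt_of_mem (a := b) (l := f a) (by simp [e])
        simp only [mu_mk]
        omega)
    have h₃ := Run.assign (.tl (.tl (.var 0)))
      (enc (([] : List β), a, (f a).foldl (h a) (g a)))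
    simp only [Expr.eval, initStore_zero, Data.tl, Expr.cost, enc_mk] at h₁ h₂ h₃
    refine (h₁.seq (h₂.seq h₃)).mono ?_
    have := Nat.mul_le_mul_right ((mu a + D a + mu (f a) + 4) ^ w + 80) (length_lt_mu (f a)).le
    dsimp only
    omega

theorem foldl_of_le_add {f : α → List β} {g : α → σ} {h : α → σ → β → σ} (hf : PolyTime f)
    (hg : PolyTime g) (hh : PolyTime fun x : α × σ × β => h x.1 x.2.1 x.2.2) {D : α → ℕ}
    (hD : PolyBdd D) (hb : ∀ a s, ∀ b ∈ f a, mu (h a s b) ≤ mu s + D a) :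
    PolyTime fun a => (f a).foldl (h a) (g a) := by
  refine foldl hf hg hh (hg.polyBdd.add (hf.polyBdd.mul hD)) fun a l hl => ?_
  have key : ∀ (l : List β) s, (∀ b ∈ l, b ∈ f a) →
      mu (l.foldl (h a) s) ≤ mu s + l.length * D a := by
    intro l
    induction l with
    | nil => simp
    | cons b l ih =>
      intro s hs
      have h₁ := ih (h a s b) fun c hc => hs c (by simp [hc])
      have h₂ := hb a s b (hs b (by simp))
      simp only [List.foldl_cons, List.length_cons]
      linarith [h₁, h₂]
  refine (key l (g a) fun b hb => hl.subset hb).trans ?_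
  have h₁ := hl.length_le
  have h₂ := length_lt_mu (f a)
  have := Nat.mul_le_mul_right (D a) (h₁.trans h₂.le)
  omega

theorem exists_bound_of_mem {f : α → List β} {h : α → β → γ} (hf : PolyTime f)
    (hh : PolyTime fun x : α × β => h x.1 x.2) :
    ∃ D : α → ℕ, PolyBdd D ∧ ∀ a, ∀ b ∈ f a, mu (h a b) ≤ D a := by
  obtain ⟨c, hc⟩ := hh.polyBdd
  refine ⟨_, ((PolyBdd.measure.add hf.polyBdd).add (.const 3)).pow c, fun a b hb => ?_⟩
  refine (hc (a, b)).trans (Nat.pow_le_pow_left ?_ c)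
  have := mu_lt_of_mem hb
  simp only [mu_mk]
  omega

theorem list_reverse {f : α → List β} (hf : PolyTime f) : PolyTime fun a => (f a).reverse :=
  (foldl_of_le_add (h := fun _ s b => b :: s) hf (const []) (id.snd.snd.list_cons id.snd.fst)
    (hf.polyBdd.add (.const 1)) fun a s b hb => by
      have := mu_lt_of_mem hb
      simp only [mu_list_cons]; omega).of_eq fun a => by simp

theorem list_map {f : α → List β} {h : α → β → γ} (hf : PolyTime f)
    (hh : PolyTime fun x : α × β => h x.1 x.2) : PolyTime fun a => (f a).map (h a) := by
  obtain ⟨D, hD, hb⟩ := exists_bound_of_mem hf hh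
  refine (list_reverse (foldl_of_le_add (h := fun a s b => h a b :: s) hf (const [])
    ((hh.comp (id.fst.pair id.snd.snd)).list_cons id.snd.fst) (hD.add (.const 1))
    fun a s b hb' => ?_)).of_eq fun a => ?_
  · have := hb a b hb'
    simp only [mu_list_cons]; omega
  · have : ∀ (l : List β) s, l.foldl (fun s b => h a b :: s) s = (l.map (h a)).reverse ++ s := by
      intro l
      induction l <;> simp_all
    simp [this]

theorem list_filter {f : α → List β} {h : α → β → Bool} (hf : PolyTime f)
    (hh : PolyTime fun x : α × β => h x.1 x.2) : PolyTime fun a => (f a).filter (h a) := by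
  refine (list_reverse (foldl_of_le_add (h := fun a s b => if h a b then b :: s else s) hf
    (const []) (cond (hh.comp (id.fst.pair id.snd.snd)) (id.snd.snd.list_cons id.snd.fst)
      id.snd.fst) (hf.polyBdd.add (.const 1)) fun a s b hb' => ?_)).of_eq fun a => ?_
  · have := mu_lt_of_mem hb'
    split_ifs
    · simp only [mu_list_cons]; omega
    · omega
  · have : ∀ (l : List β) s, l.foldl (fun s b => if h a b then b :: s else s) s =
        (l.filter (h a)).reverse ++ s := by
      intro l
      induction l with
      | nil => simp
      | cons b l ih => intro s; by_cases hb : h a b <;> simp [ih, hb]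
    simp [this]

theorem list_append {f g : α → List β} (hf : PolyTime f) (hg : PolyTime g) :
    PolyTime fun a => f a ++ g a :=
  (foldl_of_le_add (h := fun _ s b => b :: s) hf.list_reverse hg
    (id.snd.snd.list_cons id.snd.fst) (hf.polyBdd.add (.const 1)) fun a s b hb => by
      have := mu_lt_of_mem (List.mem_reverse.1 hb)
      simp only [mu_list_cons]; omega).of_eq fun a => by simp

theorem bool_not {f : α → Bool} (hf : PolyTime f) : PolyTime fun a => !f a :=
  (cond hf (const false) (const true)).of_eq fun a => by cases f a <;> rfl

theorem bool_and {f g : α → Bool} (hf : PolyTime f) (hg : PolyTime g) :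
    PolyTime fun a => f a && g a :=
  (cond hf hg (const false)).of_eq fun a => by cases f a <;> rfl

theorem bool_or {f g : α → Bool} (hf : PolyTime f) (hg : PolyTime g) :
    PolyTime fun a => f a || g a :=
  (cond hf (const true) hg).of_eq fun a => by cases f a <;> rfl

theorem list_any {f : α → List β} {h : α → β → Bool} (hf : PolyTime f)
    (hh : PolyTime fun x : α × β => h x.1 x.2) : PolyTime fun a => (f a).any (h a) := by
  refine (foldl_of_le_add (h := fun a s b => h a b || s) hf (const false)
    (bool_or (hh.comp (id.fst.pair id.snd.snd)) id.snd.fst) (.const 3)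
    fun a s b _ => (mu_bool_le _).trans (Nat.le_add_left _ _)).of_eq fun a => ?_
  have : ∀ (l : List β) s, l.foldl (fun s b => h a b || s) s = (l.any (h a) || s) := by
    intro l
    induction l with
    | nil => simp
    | cons b l ih => intro s; simp [ih]; cases h a b <;> simp
  simp [this]

theorem list_all {f : α → List β} {h : α → β → Bool} (hf : PolyTime f)
    (hh : PolyTime fun x : α × β => h x.1 x.2) : PolyTime fun a => (f a).all (h a) :=
  (bool_not (list_any (h := fun a b => !h a b) hf (bool_not hh))).of_eq fun a => by
    simp [List.all_eq_not_any_not]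

theorem list_flatMap {f : α → List β} {h : α → β → List γ} (hf : PolyTime f)
    (hh : PolyTime fun x : α × β => h x.1 x.2) : PolyTime fun a => (f a).flatMap (h a) := by
  obtain ⟨D, hD, hb⟩ := exists_bound_of_mem hf hh
  refine (foldl_of_le_add (h := fun a s b => s ++ h a b) hf (const [])
    (list_append id.snd.fst (hh.comp (id.fst.pair id.snd.snd))) hD fun a s b hb' => ?_).of_eq
    fun a => ?_
  · have : ∀ l l' : List γ, mu (l ++ l') ≤ mu l + mu l' := by
      intro l l'
      induction l with
      | nil => simp
      | cons b l ih => simp; omega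
    exact (this _ _).trans (Nat.add_le_add_left (hb a b hb') _)
  · have : ∀ (l : List β) s, l.foldl (fun s b => s ++ h a b) s = s ++ l.flatMap (h a) := by
      intro l
      induction l <;> simp_all
    simp [this]

/-! ### Arithmetic on unary numbers, and finite conjunctions and disjunctions. -/

theorem nat_succ {f : α → ℕ} (hf : PolyTime f) : PolyTime fun a => f a + 1 :=
  comp (g := fun n : ℕ => n + 1) (of_expr (.cons .nil (.var 0))
    (fun n => by simp [Expr.eval, initStore_zero])
    ((PolyBdd.measure.add (.const 2)).mono fun n => by simp only [mu_nat]; omega)) hf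

theorem nat_pred {f : α → ℕ} (hf : PolyTime f) : PolyTime fun a => f a - 1 :=
  comp (g := fun n : ℕ => n - 1) (of_expr (.tl (.var 0))
    (fun n => by cases n <;> simp [Expr.eval, initStore_zero, Data.tl])
    (PolyBdd.measure.mono fun n => by simp only [mu_nat]; omega)) hf

theorem replicate_unit {f : α → ℕ} (hf : PolyTime f) :
    PolyTime fun a => List.replicate (f a) () :=
  comp (g := fun n : ℕ => List.replicate n ())
    (of_enc_eq enc_replicate_unit fun n => (mu_replicate_unit n).le) hf

theorem nat_sub {f g : α → ℕ} (hf : PolyTime f) (hg : PolyTime g) :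
    PolyTime fun a => f a - g a := by
  refine (foldl_of_le_add (h := fun _ s _ => s - 1) hg.replicate_unit hf (nat_pred id.snd.fst)
    (.const 0) fun a s b _ => ?_).of_eq fun a => ?_
  · simp
  · have : ∀ n m : ℕ, (List.replicate n ()).foldl (fun s _ => s - 1) m = m - n := by
      intro n
      induction n with
      | zero => simp
      | succ n ih => intro m; rw [List.replicate_succ, List.foldl_cons, ih]; omega
    exact this _ _

theorem nat_eq_zero {f : α → ℕ} (hf : PolyTime f) : PolyTime fun a => decide (f a = 0) :=
  (list_cases (h := fun _ _ _ => false) hf.replicate_unit (const true) (const false)).of_eq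
    fun a => by cases f a <;> simp [List.replicate_succ]

theorem nat_le {f g : α → ℕ} (hf : PolyTime f) (hg : PolyTime g) :
    PolyTime fun a => decide (f a ≤ g a) :=
  (nat_eq_zero (nat_sub hf hg)).of_eq fun a => by simp [Nat.sub_eq_zero_iff_le]

theorem nat_eq {f g : α → ℕ} (hf : PolyTime f) (hg : PolyTime g) :
    PolyTime fun a => decide (f a = g a) :=
  (bool_and (nat_le hf hg) (nat_le hg hf)).of_eq fun a => by
    rw [← Bool.decide_and]; exact decide_eq_decide.2 (by omega)

theorem list_length {f : α → List β} (hf : PolyTime f) : PolyTime fun a => (f a).length := by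
  refine (foldl_of_le_add (h := fun _ s _ => s + 1) hf (const 0) (nat_succ id.snd.fst)
    (.const 2) fun a s b _ => ?_).of_eq fun a => ?_
  · simp; omega
  · have : ∀ (l : List β) (m : ℕ), l.foldl (fun s _ => s + 1) m = m + l.length := by
      intro l
      induction l with
      | nil => simp
      | cons b l ih => intro m; simp [ih]; omega
    simp

theorem list_range {f : α → ℕ} (hf : PolyTime f) : PolyTime fun a => List.range (f a) := by
  have : ∀ n : ℕ, (List.replicate n ()).foldl (fun s _ => s ++ [s.length]) [] = List.range n := by
    intro n
    induction n with
    | zero => simp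
    | succ n ih => rw [List.replicate_succ', List.foldl_append, ih, List.range_succ]; simp
  -- Each round appends the current length. The numbers are unary, so the list has quadratic
  -- measure.
  refine (foldl (D := fun a => mu (f a) * (mu (f a) + 1) + 1)
    (h := fun _ s _ => s ++ [s.length]) hf.replicate_unit (const [])
    (list_append id.snd.fst (id.snd.fst.list_length.list_cons (const [])))
    ((hf.polyBdd.mul (hf.polyBdd.add (.const 1))).add (.const 1)) fun a l hl => ?_).of_eq
    fun a => this _
  obtain ⟨m, hm, rfl⟩ : ∃ m ≤ f a, l = List.replicate m () := by
    refine ⟨l.length, by simpa using hl.length_le, ?_⟩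
    exact List.eq_replicate_iff.2 ⟨rfl, fun _ _ => rfl⟩
  rw [this]
  refine (mu_list_le (m := mu (f a)) fun b hb => ?_).trans ?_
  · have := List.mem_range.1 hb
    simp only [mu_nat]; omega
  · have : m ≤ mu (f a) := by simp only [mu_nat]; omega
    simpa using Nat.mul_le_mul_right (mu (f a) + 1) this

theorem list_getD {f : α → List β} {g : α → ℕ} {b : β} (hb : enc b = .nil) (hf : PolyTime f)
    (hg : PolyTime g) : PolyTime fun a => (f a).getD (g a) b := by
  refine (list_headD hb (foldl_of_le_add (h := fun _ s _ => s.tail) hg.replicate_unit hf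
    (list_tail id.snd.fst) (.const 0) fun a s b _ => ?_)).of_eq fun a => ?_
  · cases s <;> simp; omega
  · have : ∀ (n : ℕ) (l : List β), (List.replicate n ()).foldl (fun s _ => s.tail) l = l.drop n := by
      intro n
      induction n with
      | zero => simp
      | succ n ih => intro l; rw [List.replicate_succ, List.foldl_cons, ih]; simp
    rw [this]
    simp [List.headD_eq_head?_getD, List.getD_eq_getElem?_getD]

theorem fin_all {d : ℕ} {b : Fin d → α → Bool} (h : ∀ j, PolyTime (b j)) :
    PolyTime fun a => decide (∀ j, b j a = true) := by
  induction d with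
  | zero => exact (const true).of_eq fun a => by simp
  | succ d ih =>
    exact (bool_and (h 0) (ih fun j => h j.succ)).of_eq fun a => by
      simp [Fin.forall_fin_succ]

theorem fin_any {d : ℕ} {b : Fin d → α → Bool} (h : ∀ j, PolyTime (b j)) :
    PolyTime fun a => decide (∃ j, b j a = true) :=
  (bool_not (fin_all fun j => bool_not (h j))).of_eq fun a => by
    by_cases hb : ∃ j, b j a = true
    · rw [decide_eq_true hb, decide_eq_false (by simpa using hb)]; rfl
    · rw [decide_eq_false hb, decide_eq_true (by simpa using hb)]; rfl

end PolyTime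

open Turing.ToPartrec

/-! ## Computable functions have programs with computable running time -/

theorem hd_enc_list (v : List ℕ) : (enc v).hd = enc v.headI := by cases v <;> rfl

theorem tl_enc_list {α : Type} [Enc α] (v : List α) : (enc v).tl = enc v.tail := by
  cases v <;> rfl

theorem enc_nat_eq_nil {n : ℕ} : enc n = Data.nil ↔ n = 0 := by cases n <;> simp

/-- The program `p` computes the partial function `f` within the time `E`, where `E` also returns
the value. -/
def ComputesIn (p : Prog) (f : List ℕ →. List ℕ) (E : List ℕ →. List ℕ × ℕ) : Prop :=
  Partrec E ∧ ∀ v w, w ∈ f v → ∃ t, (w, t) ∈ E v ∧ Run p (enc v) (enc w) t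

theorem computesIn_expr {e : Expr} {g : List ℕ → List ℕ} (hg : Computable g)
    (he : ∀ v, e.eval (initStore (enc v)) = enc (g v)) :
    ComputesIn (.assign 0 e) (fun v => pure (g v)) (fun v => Part.some (g v, e.cost + 1)) := by
  refine ⟨(hg.pair (Computable.const _)).partrec, fun v w hw => ?_⟩
  obtain rfl := Part.mem_some_iff.1 hw
  exact ⟨_, Part.mem_some _, he v ▸ Run.assign e (enc v)⟩

theorem ComputesIn.cons {p q : Prog} {f g : List ℕ →. List ℕ} {E F : List ℕ →. List ℕ × ℕ}
    (hp : ComputesIn p f E) (hq : ComputesIn q g F) :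
    ComputesIn (Prog.pair (.seq p (.assign 0 (.hd (.var 0)))) q)
      (fun v => (f v).bind fun n => (g v).bind fun ns => Part.some (n.headI :: ns))
      (fun v => (E v).bind fun x => (F v).map fun y => (x.1.headI :: y.1, x.2 + y.2 + 40)) := by
  refine ⟨?_, fun v w hw => ?_⟩
  · refine hp.1.bind (Partrec.map (hq.1.comp Computable.fst) ?_)
    refine Primrec.to_comp ?_
    refine Primrec.pair (Primrec.list_cons.comp (Primrec.list_headI.comp ?_) ?_)
      (Primrec.nat_add.comp (Primrec.nat_add.comp ?_ ?_) (Primrec.const 40))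
    · exact Primrec.fst.comp (Primrec.snd.comp Primrec.fst)
    · exact Primrec.fst.comp Primrec.snd
    · exact Primrec.snd.comp (Primrec.snd.comp Primrec.fst)
    · exact Primrec.snd.comp Primrec.snd
  · simp only [Part.mem_bind_iff, Part.mem_some_iff] at hw
    obtain ⟨n, hn, ns, hns, rfl⟩ := hw
    obtain ⟨t, ht, rt⟩ := hp.2 v n hn
    obtain ⟨u, hu, ru⟩ := hq.2 v ns hns
    refine ⟨t + u + 40, ?_, ?_⟩
    · simp only [Part.mem_bind_iff, Part.mem_map_iff]
      exact ⟨_, ht, _, hu, rfl⟩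
    · have := Run.assign (.hd (.var 0)) (enc n)
      simp only [Expr.eval, initStore_zero, hd_enc_list, Expr.cost] at this
      exact ((rt.seq this).pair ru).mono (by omega)

theorem ComputesIn.comp {p q : Prog} {f g : List ℕ →. List ℕ} {E F : List ℕ →. List ℕ × ℕ}
    (hp : ComputesIn p f E) (hq : ComputesIn q g F) :
    ComputesIn (.seq q p) (fun v => (g v).bind f)
      (fun v => (F v).bind fun x => (E x.1).map fun y => (y.1, x.2 + y.2 + 1)) := by
  refine ⟨?_, fun v w hw => ?_⟩
  · refine hq.1.bind (Partrec.map (hp.1.comp (Computable.fst.comp Computable.snd)) ?_)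
    refine Primrec.to_comp ?_
    refine Primrec.pair ?_ (Primrec.nat_add.comp (Primrec.nat_add.comp ?_ ?_) (Primrec.const 1))
    · exact Primrec.fst.comp Primrec.snd
    · exact Primrec.snd.comp (Primrec.snd.comp Primrec.fst)
    · exact Primrec.snd.comp Primrec.snd
  · obtain ⟨y, hy, hw⟩ := Part.mem_bind_iff.1 hw
    obtain ⟨t, ht, rt⟩ := hq.2 v y hy
    obtain ⟨u, hu, ru⟩ := hp.2 y w hw
    refine ⟨t + u + 1, ?_, rt.seq ru⟩
    simp only [Part.mem_bind_iff, Part.mem_map_iff]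
    exact ⟨_, ht, _, hu, rfl⟩

theorem ComputesIn.case {p q : Prog} {f g : List ℕ →. List ℕ} {E F : List ℕ →. List ℕ × ℕ}
    (hp : ComputesIn p f E) (hq : ComputesIn q g F) :
    ComputesIn (.ite (.hd (.var 0))
        (.seq (.assign 0 (.cons (.tl (.hd (.var 0))) (.tl (.var 0)))) q)
        (.seq (.assign 0 (.tl (.var 0))) p))
      (fun v => v.headI.rec (f v.tail) fun y _ => g (y :: v.tail))
      (fun v => (bif decide (v.headI = 0) then E v.tail else F ((v.headI - 1) :: v.tail)).map
        fun x => (x.1, x.2 + 20)) := by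
  refine ⟨?_, fun v w hw => ?_⟩
  · refine Partrec.map (Partrec.cond ?_ (hp.1.comp Primrec.list_tail.to_comp) (hq.1.comp ?_)) ?_
    · exact (Primrec.eq.comp Primrec.list_headI (Primrec.const 0)).decide.to_comp
    · exact (Primrec.list_cons.comp (Primrec.nat_sub.comp Primrec.list_headI (Primrec.const 1))
        Primrec.list_tail).to_comp
    · refine Primrec.to_comp (Primrec.pair ?_ (Primrec.nat_add.comp ?_ (Primrec.const 20)))
      · exact Primrec.fst.comp Primrec.snd
      · exact Primrec.snd.comp Primrec.snd
  · have h₁ := Run.assign (.tl (.var 0)) (enc v)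
    have h₂ := Run.assign (.cons (.tl (.hd (.var 0))) (.tl (.var 0))) (enc v)
    simp only [Expr.eval, initStore_zero, hd_enc_list, tl_enc_list, Expr.cost] at h₁ h₂
    cases hv : v.headI with
    | zero =>
      simp only [hv] at hw
      obtain ⟨t, ht, rt⟩ := hp.2 _ w hw
      refine ⟨t + 20, ?_, ?_⟩
      · dsimp only
        rw [hv]
        exact Part.mem_map_iff _ |>.2 ⟨_, ht, rfl⟩
      · refine (Run.ite_false ?_ (h₁.seq rt)).mono (by simp only [Expr.cost]; omega)
        simp [Expr.eval, initStore_zero, hd_enc_list, hv]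
    | succ n =>
      simp only [hv] at hw
      obtain ⟨t, ht, rt⟩ := hq.2 _ w hw
      refine ⟨t + 20, ?_, ?_⟩
      · dsimp only
        rw [hv]
        exact Part.mem_map_iff _ |>.2 ⟨_, ht, rfl⟩
      · simp only [hv, enc_succ, Data.tl] at h₂
        refine (Run.ite_true ?_ (h₂.seq rt)).mono (by simp only [Expr.cost]; omega)
        simp [Expr.eval, initStore_zero, hd_enc_list, hv]

/-- The running time is obtained by iterating the same body with a clock added to the state; the
clocked iteration is again partial recursive. -/
theorem ComputesIn.fix {p : Prog} {f : List ℕ →. List ℕ} {E : List ℕ →. List ℕ × ℕ}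
    (hp : ComputesIn p f E) :
    ∃ F, ComputesIn
      (.seq p (.seq (.loop (.hd (.var 0)) (.seq (.assign 0 (.tl (.var 0))) p))
        (.assign 0 (.tl (.var 0)))))
      (PFun.fix fun v => (f v).map fun v => if v.headI = 0 then .inl v.tail else .inr v.tail) F := by
  set L : Prog := .loop (.hd (.var 0)) (.seq (.assign 0 (.tl (.var 0))) p) with hL
  -- The second component is the time spent so far.
  let K : List ℕ × ℕ →. (List ℕ × ℕ) ⊕ (List ℕ × ℕ) := fun x => (E x.1).map fun y =>
    bif decide (y.1.headI = 0) then .inl (y.1.tail, x.2 + y.2 + 20)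
    else .inr (y.1.tail, x.2 + y.2 + 20)
  have hK : Partrec K := by
    have h : Primrec fun z : (List ℕ × ℕ) × (List ℕ × ℕ) => (z.2.1.tail, z.1.2 + z.2.2 + 20) :=
      Primrec.pair (Primrec.list_tail.comp (Primrec.fst.comp Primrec.snd))
        (Primrec.nat_add.comp (Primrec.nat_add.comp (Primrec.snd.comp Primrec.fst)
          (Primrec.snd.comp Primrec.snd)) (Primrec.const 20))
    refine Partrec.map (hp.1.comp Computable.fst) (Primrec.to_comp ?_)
    exact Primrec.cond (Primrec.eq.comp (Primrec.list_headI.comp (Primrec.fst.comp Primrec.snd))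
      (Primrec.const 0)).decide (Primrec.sumInl.comp h) (Primrec.sumInr.comp h)
  refine ⟨fun v => (PFun.fix K (v, 0)).map fun x => (x.1, x.2 + 20), ?_, fun v w hw => ?_⟩
  · refine Partrec.map (hK.fix.comp (Primrec.pair Primrec.id (Primrec.const 0)).to_comp)
      (Primrec.to_comp ?_)
    exact Primrec.pair (Primrec.fst.comp Primrec.snd)
      (Primrec.nat_add.comp (Primrec.snd.comp Primrec.snd) (Primrec.const 20))
  -- The body runs once before the guard is tested, hence a run of `p` followed by one of `L`. The
  -- clock may start at any value `acc`, as the induction requires.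
  · have key : ∃ (y z : List ℕ) (t u T : ℕ), Run p (enc v) (enc y) t ∧ Run L (enc y) (enc z) u ∧
        z.tail = w ∧ t + u ≤ T ∧ ∀ acc, (w, acc + T) ∈ PFun.fix K (v, acc) := by
      refine PFun.fixInduction (C := fun v => ∃ (y z : List ℕ) (t u T : ℕ), Run p (enc v) (enc y) t ∧
        Run L (enc y) (enc z) u ∧ z.tail = w ∧ t + u ≤ T ∧
          ∀ acc, (w, acc + T) ∈ PFun.fix K (v, acc)) hw fun v hv ih => ?_
      have hy : ∃ y, y ∈ f v := by
        have := PFun.dom_of_mem_fix hv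
        exact ⟨(f v).get this, Part.get_mem _⟩
      obtain ⟨y, hy⟩ := hy
      obtain ⟨t, ht, rt⟩ := hp.2 v y hy
      by_cases h0 : y.headI = 0
      · have hl := Run.loop_false (e := .hd (.var 0)) (p := .seq (.assign 0 (.tl (.var 0))) p)
          (x := enc y) (by simp [Expr.eval, initStore_zero, hd_enc_list, h0])
        have hw' : y.tail = w := by
          refine Part.mem_unique (PFun.fix_stop ?_) hv
          exact Part.mem_map_iff _ |>.2 ⟨y, hy, by simp [h0]⟩
        refine ⟨y, y, t, _, t + 20, rt, hl, hw', by simp [Expr.cost], fun acc => ?_⟩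
        refine PFun.fix_stop (Part.mem_map_iff _ |>.2 ⟨_, ht, ?_⟩)
        simp [h0, hw', add_assoc]
      · obtain ⟨y', z, t', u, T, rt', ru, hz, hT, hfix⟩ := ih y.tail
          (Part.mem_map_iff _ |>.2 ⟨y, hy, by simp [h0]⟩)
        have h₁ := Run.assign (.tl (.var 0)) (enc y)
        simp only [Expr.eval, initStore_zero, tl_enc_list, Expr.cost] at h₁
        have h₂ := Run.loop_true (e := .hd (.var 0))
          (by simpa [Expr.eval, initStore_zero, hd_enc_list, enc_nat_eq_nil] using h0)
          (h₁.seq rt') ru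
        refine ⟨y, z, t, _, t + 20 + T, rt, h₂, hz, by simp only [Expr.cost]; omega, fun acc => ?_⟩
        have h₃ : Sum.inr (y.tail, acc + t + 20) ∈ K (v, acc) :=
          Part.mem_map_iff _ |>.2 ⟨_, ht, by simp [h0]⟩
        rw [PFun.fix_fwd_eq h₃]
        simpa [add_assoc] using hfix (acc + t + 20)
    obtain ⟨y, z, t, u, T, rt, ru, rfl, hT, hfix⟩ := key
    refine ⟨T + 20, Part.mem_map_iff _ |>.2 ⟨_, hfix 0, by simp⟩, ?_⟩
    have h₁ := Run.assign (.tl (.var 0)) (enc z)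
    simp only [Expr.eval, initStore_zero, tl_enc_list, Expr.cost] at h₁
    exact (rt.seq (ru.seq h₁)).mono (by omega)

theorem exists_computesIn (c : Code) : ∃ p E, ComputesIn p c.eval E := by
  induction c with
  | zero' =>
    rw [Code.zero'_eval]
    exact ⟨_, _, computesIn_expr (e := .cons .nil (.var 0))
      (Primrec.list_cons.comp (Primrec.const 0) Primrec.id).to_comp
      fun v => by simp [Expr.eval, initStore_zero]⟩
  | succ =>
    rw [Code.succ_eval]
    exact ⟨_, _, computesIn_expr (e := .cons (.cons .nil (.hd (.var 0))) .nil)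
      (Primrec.list_cons.comp (Primrec.succ.comp Primrec.list_headI) (Primrec.const [])).to_comp
      fun v => by simp [Expr.eval, initStore_zero, hd_enc_list]⟩
  | tail =>
    rw [Code.tail_eval]
    exact ⟨_, _, computesIn_expr (e := .tl (.var 0)) Primrec.list_tail.to_comp
      fun v => by simp [Expr.eval, initStore_zero, tl_enc_list]⟩
  | cons f fs ihf ihfs =>
    obtain ⟨p, E, hp⟩ := ihf
    obtain ⟨q, F, hq⟩ := ihfs
    rw [Code.cons_eval]
    exact ⟨_, _, hp.cons hq⟩
  | comp f g ihf ihg =>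
    obtain ⟨p, E, hp⟩ := ihf
    obtain ⟨q, F, hq⟩ := ihg
    rw [Code.comp_eval]
    exact ⟨_, _, hp.comp hq⟩
  | case f g ihf ihg =>
    obtain ⟨p, E, hp⟩ := ihf
    obtain ⟨q, F, hq⟩ := ihg
    rw [Code.case_eval]
    exact ⟨_, _, hp.case hq⟩
  | fix f ih =>
    obtain ⟨p, E, hp⟩ := ih
    obtain ⟨F, hF⟩ := hp.fix
    rw [Code.fix_eval]
    exact ⟨_, F, hF⟩

/-- The time is a partial recursive function that is defined wherever the value is. As `s` is total,
so is the time, which is therefore computable. -/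
theorem exists_run_of_computable {s : ℕ → ℕ} (hs : Computable s) :
    ∃ (p : Prog) (T : ℕ → ℕ), Computable T ∧ ∀ k, Run p (enc k) (enc (s k)) (T k) := by
  have h₁ : Nat.Partrec' fun v : List.Vector ℕ 1 => (s : ℕ →. ℕ) v.head :=
    Nat.Partrec'.part_iff₁.2 hs.partrec
  obtain ⟨c, hc⟩ := Code.exists_code h₁
  obtain ⟨p, E, hE, hp⟩ := exists_computesIn c
  have hr : ∀ k, ∃ t, ([s k], t) ∈ E [k] ∧ Run p (enc [k]) (enc [s k]) t := fun k => by
    refine hp [k] [s k] ?_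
    have := hc ⟨[k], rfl⟩
    change c.eval [k] = _ at this
    rw [this]
    simp [List.Vector.head]
  choose T hT hrun using hr
  refine ⟨.seq (.assign 0 (.cons (.var 0) .nil)) (.seq p (.assign 0 (.hd (.var 0)))),
    fun k => T k + 20, ?_, fun k => ?_⟩
  · have h₂ : Computable T := by
      refine Partrec.of_eq (f := fun k => (E [k]).map Prod.snd) ?_ fun k => ?_
      · exact Partrec.map (hE.comp (Primrec.list_cons.comp Primrec.id (Primrec.const [])).to_comp)
          (Computable.snd.comp Computable.snd)
      · exact Part.eq_some_iff.2 (Part.mem_map_iff _ |>.2 ⟨_, hT k, rfl⟩)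
    exact (Primrec.nat_add.comp Primrec.id (Primrec.const 20)).to_comp.comp h₂
  · have h₁ := Run.assign (.cons (.var 0) .nil) (enc k)
    have h₂ := Run.assign (.hd (.var 0)) (enc [s k])
    simp only [Expr.eval, initStore_zero, hd_enc_list, Expr.cost] at h₁ h₂
    exact (h₁.seq ((hrun k).seq h₂)).mono (by dsimp only; omega)

/-! ## Connected sets and vertex deletion -/

section Connected

variable {V W : Type}

theorem reachable_propagate {G : SimpleGraph V} {P : V → Prop}
    (h : ∀ u v, G.Adj u v → P u → P v) {u v : V} (r : G.Reachable u v) (hu : P u) : P v := by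
  obtain ⟨p⟩ := r
  induction p with
  | nil => exact hu
  | cons hadj _ ih => exact ih (h _ _ hadj hu)

theorem connected_propagate {G : SimpleGraph V} {S : Set V} (hS : (G.induce S).Connected)
    {P : V → Prop} (h : ∀ u ∈ S, ∀ v ∈ S, G.Adj u v → P u → P v) {u v : V} (hu : u ∈ S) (hv : v ∈ S)
    (hP : P u) : P v :=
  reachable_propagate (G := G.induce S) (P := fun x => P x.1)
    (fun x y hxy => h x.1 x.2 y.1 y.2 hxy) (hS.preconnected ⟨u, hu⟩ ⟨v, hv⟩) hP

theorem GraphClass.IsHereditary.mem_of_embedding {Γ : GraphClass} (hΓ : Γ.IsHereditary) [Finite V]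
    [Finite W] {H : SimpleGraph V} {G : SimpleGraph W} (f : H ↪g G) (hG : Γ.Mem G) : Γ.Mem H := by
  refine Γ.mem_of_iso _ _ ⟨RelIso.symm ?_⟩ (hΓ G (Set.range f) hG)
  exact ⟨Equiv.ofInjective f f.injective, by simp⟩

/-- The isomorphism onto the subgraph induced by the image of a vertex set. -/
noncomputable def induceImageIso {H : SimpleGraph V} {G : SimpleGraph W} (f : H ↪g G) (S : Set V) :
    H.induce S ≃g G.induce (f '' S) :=
  ⟨Equiv.Set.image f S f.injective, by simp⟩

/-- Every connected subset of `X` induces a member of one of the classes. -/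
def ConnectedIn {ι : Type} (Γ : ι → GraphClass) [Finite V] (G : SimpleGraph V) (X : Set V) : Prop :=
  ∀ S ⊆ X, (G.induce S).Connected → ∃ i, (Γ i).Mem (G.induce S)

theorem ConnectedIn.mono {ι : Type} {Γ : ι → GraphClass} [Finite V] {G : SimpleGraph V}
    {X Y : Set V} (h : ConnectedIn Γ G Y) (hXY : X ⊆ Y) : ConnectedIn Γ G X :=
  fun S hS => h S (hS.trans hXY)

/-- A connected set lies in a single component, so heredity passes membership on to it; conversely
components are connected sets. The right-hand side is monotone in the vertex set and stays inside
`G`, which spares all later arguments from changing the vertex type. -/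
theorem componentsIn_iff {ι : Type} {Γ : ι → GraphClass} (hΓ : ∀ i, (Γ i).IsHereditary) [Finite V]
    [Finite W] {H : SimpleGraph V} {G : SimpleGraph W} (f : H ↪g G) :
    ComponentsIn Γ H ↔ ConnectedIn Γ G (Set.range f) := by
  constructor
  · intro h S hS hc
    obtain ⟨S', rfl⟩ := Set.subset_range_iff_exists_image_eq.1 hS
    have hc' := (induceImageIso f S').connected_iff.2 hc
    obtain ⟨v⟩ := hc'.nonempty
    obtain ⟨i, hi⟩ := h (H.connectedComponentMk v)
    have hsub : S' ⊆ (H.connectedComponentMk v.1).supp := fun u hu => by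
      have := hc'.preconnected ⟨u, hu⟩ v
      exact SimpleGraph.ConnectedComponent.sound (this.map (SimpleGraph.Embedding.induce S').toHom)
    exact ⟨i, GraphClass.IsHereditary.mem_of_embedding (hΓ i)
      ((SimpleGraph.induceHomOfLE H hsub).comp (induceImageIso f S').symm.toEmbedding) hi⟩
  · intro h C
    have hc : (H.induce C.supp).Connected := C.connected_toSimpleGraph
    obtain ⟨i, hi⟩ := h (f '' C.supp) (Set.image_subset_range _ _)
      ((induceImageIso f C.supp).connected_iff.1 hc)
    exact ⟨i, GraphClass.IsHereditary.mem_of_embedding (hΓ i) (induceImageIso f C.supp).toEmbedding hi⟩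

end Connected

/-- Calls to the given algorithms concern re-indexed induced subgraphs; this reads their answers in
`G`. Vertices of `Z` outside the range of `f` do no harm. -/
theorem vertexDeletion_comap_iff {ι : Type} {Γ : ι → GraphClass} (hΓ : ∀ i, (Γ i).IsHereditary)
    {n m : ℕ} (G : SimpleGraph (Fin n)) (f : Fin m ↪ Fin n) (k : ℕ) :
    VertexDeletion Γ m (G.comap f) k ↔
      ∃ Z : Finset (Fin n), Z.card ≤ k ∧ ConnectedIn Γ G (Set.range f \ Z) := by
  have key : ∀ Z₀ : Finset (Fin m), ComponentsIn Γ ((G.comap f).induce {v | v ∉ Z₀}) ↔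
      ConnectedIn Γ G (f '' {v | v ∉ Z₀}) := fun Z₀ => by
    rw [componentsIn_iff hΓ ((SimpleGraph.Embedding.comap f G).comp
      (SimpleGraph.Embedding.induce {v | v ∉ Z₀}))]
    refine iff_of_eq (congrArg _ ?_)
    ext v
    constructor
    · rintro ⟨u, rfl⟩
      exact ⟨u.1, u.2, rfl⟩
    · rintro ⟨u, hu, rfl⟩
      exact ⟨⟨u, hu⟩, rfl⟩
  constructor
  · rintro ⟨Z₀, hZ, h⟩
    refine ⟨Z₀.map f, by simpa using hZ, ((key Z₀).1 h).mono ?_⟩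
    rintro _ ⟨⟨v, rfl⟩, hv⟩
    exact ⟨v, by simpa using hv, rfl⟩
  · rintro ⟨Z, hZ, h⟩
    refine ⟨Z.preimage f f.injective.injOn, ?_, (key _).2 (h.mono ?_)⟩
    · refine le_trans ?_ hZ
      rw [← Finset.card_map f]
      exact Finset.card_le_card fun v hv => by
        obtain ⟨u, hu, rfl⟩ := Finset.mem_map.1 hv
        simpa using hu
    · rintro _ ⟨v, hv, rfl⟩
      exact ⟨⟨v, rfl⟩, by simpa using hv⟩

theorem vertexDeletion_iff {ι : Type} {Γ : ι → GraphClass} (hΓ : ∀ i, (Γ i).IsHereditary)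
    {n : ℕ} (G : SimpleGraph (Fin n)) (k : ℕ) :
    VertexDeletion Γ n G k ↔ ∃ Z : Finset (Fin n), Z.card ≤ k ∧ ConnectedIn Γ G (Z : Set (Fin n))ᶜ := by
  have := vertexDeletion_comap_iff hΓ G (Function.Embedding.refl _) k
  rw [show Set.range (Function.Embedding.refl (Fin n)) = Set.univ from Set.range_id] at this
  simp only [Set.compl_eq_univ_sdiff]
  exact this

/-! ## Labellings -/

section Labelling

variable {d n : ℕ}

/-- A labelling of the vertices as deleted (`none`) or by one of the classes, such that vertices
with different classes are not adjacent and every class contains the connected sets labelled by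
it. -/
structure IsSolution (Γ : Fin d → GraphClass) (G : SimpleGraph (Fin n)) (k : ℕ)
    (lab : Fin n → Option (Fin d)) : Prop where
  card_le : (Finset.univ.filter fun v => lab v = none).card ≤ k
  adj : ∀ u v, G.Adj u v → lab u = none ∨ lab v = none ∨ lab u = lab v
  mem : ∀ j, ConnectedIn (fun _ : Unit => Γ j) G {v | lab v = some j}

/-- A connected set without deleted vertices carries a single label, because labels agree along its
edges. -/
theorem IsSolution.vertexDeletion {Γ : Fin d → GraphClass} (hΓ : ∀ i, (Γ i).IsHereditary)
    {G : SimpleGraph (Fin n)} {k : ℕ} {lab : Fin n → Option (Fin d)} (h : IsSolution Γ G k lab) :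
    VertexDeletion Γ n G k := by
  refine (vertexDeletion_iff hΓ G k).2 ⟨_, h.card_le, fun S hS hc => ?_⟩
  obtain ⟨v, hv⟩ := hc.nonempty
  have hn : ∀ u ∈ S, lab u ≠ none := fun u hu => by simpa using hS hu
  obtain ⟨j, hj⟩ := Option.ne_none_iff_exists'.1 (hn v hv)
  have hm := h.mem j S (fun u hu => connected_propagate hc (P := fun u => lab u = some j)
    (fun u hu w hw hadj hP => by
      rcases h.adj u w hadj with h | h | h
      · exact absurd h (hn u hu)
      · exact absurd h (hn w hw)
      · rwa [← h]) hv hu hj) hc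
  exact ⟨j, hm.choose_spec⟩

/-- The graph with the edges at the vertices of `Z` removed. -/
def isolate (G : SimpleGraph (Fin n)) (Z : Finset (Fin n)) : SimpleGraph (Fin n) where
  Adj u v := G.Adj u v ∧ u ∉ Z ∧ v ∉ Z
  symm := ⟨fun _ _ h => ⟨h.1.symm, h.2.2, h.2.1⟩⟩
  loopless := ⟨fun _ h => h.1.ne rfl⟩

/-- A set closed under adjacency in `G - Z` is separated by `Z` from the rest, so one of the two
sides is small. -/
theorem IsUnbreakable.lt_or_lt {G : SimpleGraph (Fin n)} {s k : ℕ} (hG : IsUnbreakable G s k)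
    {Z X : Finset (Fin n)} (hZ : Z.card ≤ k) (hXZ : Disjoint X Z)
    (hX : ∀ u ∈ X, ∀ v, (isolate G Z).Adj u v → v ∈ X) :
    X.card < s ∨ (Xᶜ \ Z).card < s := by
  by_contra! hcon
  refine hG ⟨X, Z, Xᶜ \ Z, ?_, hXZ, ?_, ?_, ?_, hZ, hcon.1, hcon.2⟩
  · ext v; simp; tauto
  · exact Finset.disjoint_left.2 fun v hv hv' => by simp at hv'; exact hv'.1 hv
  · exact Finset.disjoint_left.2 fun v hv hv' => by simp at hv'; exact hv'.2 hv
  · intro u hu v hv hadj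
    simp only [Finset.mem_sdiff, Finset.mem_compl] at hv
    exact hv.1 (hX u hu v ⟨hadj, Finset.disjoint_left.1 hXZ hu, hv.2⟩)

open Classical in
-- If a component has at least `s` vertices, fewer than `s` lie outside it. If all components are
-- smaller, then `G - Z` itself has at most `3 * s` vertices and any component will do; `k < n`
-- ensures that there is one.
theorem exists_small_complement {G : SimpleGraph (Fin n)} {s k : ℕ} (hG : IsUnbreakable G s k)
    {Z : Finset (Fin n)} (hZ : Z.card ≤ k) (hn : k < n) :
    ∃ v ∉ Z, (Finset.univ.filter fun u => u ∉ Z ∧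
      u ∉ ((isolate G Z).connectedComponentMk v).supp).card ≤ 3 * s := by
  set H := isolate G Z
  have hsub : ∀ v ∉ Z, ∀ u ∈ (H.connectedComponentMk v).supp, u ∉ Z := fun v hv u hu =>
    reachable_propagate (G := H) (P := fun u => u ∉ Z) (fun a b hab _ => hab.2.2)
      (SimpleGraph.ConnectedComponent.exact hu).symm hv
  have hclosed : ∀ v, ∀ u ∈ (H.connectedComponentMk v).supp, ∀ w, H.Adj u w →
      w ∈ (H.connectedComponentMk v).supp := fun v u hu w huw => by
    have := SimpleGraph.ConnectedComponent.sound huw.reachable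
    rw [SimpleGraph.ConnectedComponent.mem_supp_iff] at hu ⊢
    rw [← hu, this]
  obtain ⟨v₀, hv₀⟩ : ∃ v, v ∉ Z := by
    by_contra! h
    have := Finset.card_le_card (fun v _ => h v : Finset.univ ⊆ Z)
    simp at this
    omega
  let C : Fin n → Finset (Fin n) := fun v =>
    Finset.univ.filter fun u => u ∈ (H.connectedComponentMk v).supp
  have hCZ : ∀ v ∉ Z, Disjoint (C v) Z := fun v hv => Finset.disjoint_left.2 fun u hu =>
    hsub v hv u (by simpa [C] using hu)
  have hCcl : ∀ v, ∀ u ∈ C v, ∀ w, H.Adj u w → w ∈ C v := fun v u hu w huw => by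
    simpa [C] using hclosed v u (by simpa [C] using hu) w huw
  by_cases hbig : ∃ v ∉ Z, s ≤ (C v).card
  · obtain ⟨v, hv, hs⟩ := hbig
    refine ⟨v, hv, ?_⟩
    have := (hG.lt_or_lt hZ (hCZ v hv) (hCcl v)).resolve_left (by omega)
    refine le_trans (Finset.card_le_card fun u hu => ?_) (this.le.trans (by omega))
    simp only [Finset.mem_filter, Finset.mem_univ, true_and] at hu
    simpa [C] using hu.symm
  · push Not at hbig
    refine ⟨v₀, hv₀, ?_⟩
    -- Take a largest union of components with fewer than `s` vertices. One more component brings it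
    -- to at least `s` but fewer than `2 * s` vertices, so fewer than `s` remain outside.
    let fam : Finset (Finset (Fin n)) := Finset.univ.filter fun X =>
      Disjoint X Z ∧ (∀ u ∈ X, ∀ w, H.Adj u w → w ∈ X) ∧ X.card < s
    have hspos : 0 < s := by have := hbig v₀ hv₀; omega
    obtain ⟨X, hX, hmax⟩ := fam.exists_max_image Finset.card ⟨∅, by simp [fam, hspos]⟩
    simp only [fam, Finset.mem_filter, Finset.mem_univ, true_and] at hX hmax
    obtain ⟨hXZ, hXcl, hXs⟩ := hX
    have hall : (Finset.univ \ Z).card ≤ 3 * s := by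
      by_cases hv : ∃ v ∉ Z, v ∉ X
      · obtain ⟨v, hvZ, hvX⟩ := hv
        have hd : Disjoint (X ∪ C v) Z := Finset.disjoint_union_left.2 ⟨hXZ, hCZ v hvZ⟩
        have hcl : ∀ u ∈ X ∪ C v, ∀ w, H.Adj u w → w ∈ X ∪ C v := fun u hu w huw => by
          rcases Finset.mem_union.1 hu with hu | hu
          · exact Finset.mem_union_left _ (hXcl u hu w huw)
          · exact Finset.mem_union_right _ (hCcl v u hu w huw)
        have hlt : X.card < (X ∪ C v).card := Finset.card_lt_card
          ⟨Finset.subset_union_left, fun h => hvX (h (Finset.mem_union_right _ (by simp [C])))⟩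
        have hge : s ≤ (X ∪ C v).card := by
          by_contra! h
          have := hmax _ ⟨hd, hcl, h⟩
          omega
        have h₁ := (hG.lt_or_lt hZ hd hcl).resolve_left (by omega)
        have h₂ := Finset.card_union_le X (C v)
        have h₃ := hbig v hvZ
        have h₄ : (Finset.univ \ Z).card ≤ ((X ∪ C v) ∪ ((X ∪ C v)ᶜ \ Z)).card :=
          Finset.card_le_card fun u hu => by
            simp only [Finset.mem_sdiff, Finset.mem_univ, true_and, Finset.mem_union,
              Finset.mem_compl] at hu ⊢
            tauto
        have h₅ := Finset.card_union_le (X ∪ C v) ((X ∪ C v)ᶜ \ Z)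
        omega
      · push Not at hv
        have := Finset.card_le_card (fun u hu => hv u (by simpa using hu) : Finset.univ \ Z ⊆ X)
        omega
    refine le_trans (Finset.card_le_card fun u hu => ?_) hall
    simp only [Finset.mem_filter, Finset.mem_univ, true_and] at hu
    simpa using hu.1

/-- A solution all of whose classes but `i` are small and have no component in the class `i`. -/
structure IsSmallSolution (Γ : Fin d → GraphClass) (G : SimpleGraph (Fin n)) (k r : ℕ) (i : Fin d)
    (lab : Fin n → Option (Fin d)) : Prop extends IsSolution Γ G k lab where
  card_other_le : (Finset.univ.filter fun v => lab v ≠ none ∧ lab v ≠ some i).card ≤ r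
  exists_not_mem : ∀ v, lab v ≠ none → lab v ≠ some i → ∃ S : Set (Fin n), v ∈ S ∧
    (G.induce S).Connected ∧ (∀ u ∈ S, lab u = lab v) ∧ ¬ (Γ i).Mem (G.induce S)

open Classical in
-- The class `i` is that of the dominating component and is preferred wherever it is allowed.
-- Components with another label are then outside class `i`, and so differ from the dominating one.
theorem exists_isSmallSolution {Γ : Fin d → GraphClass} (hΓ : ∀ i, (Γ i).IsHereditary)
    {G : SimpleGraph (Fin n)} {s k : ℕ} (hG : IsUnbreakable G s k) (hn : k < n)
    (h : VertexDeletion Γ n G k) : ∃ i lab, IsSmallSolution Γ G k (3 * s) i lab := by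
  obtain ⟨Z, hZ, hgood⟩ := (vertexDeletion_iff hΓ G k).1 h
  obtain ⟨v₀, hv₀, hcard⟩ := exists_small_complement hG hZ hn
  set H := isolate G Z
  have hsub : ∀ v ∉ Z, ∀ u ∈ (H.connectedComponentMk v).supp, u ∉ Z := fun v hv u hu =>
    reachable_propagate (G := H) (P := fun u => u ∉ Z) (fun a b hab _ => hab.2.2)
      (SimpleGraph.ConnectedComponent.exact hu).symm hv
  have hconn : ∀ c : H.ConnectedComponent, (G.induce c.supp).Connected := fun c =>
    SimpleGraph.Connected.mono (G := H.induce c.supp) (fun _ _ hab => And.left hab)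
      c.connected_toSimpleGraph
  have hex : ∀ v ∉ Z, ∃ j, (Γ j).Mem (G.induce (H.connectedComponentMk v).supp) := fun v hv =>
    hgood _ (fun u hu => hsub v hv u hu) (hconn _)
  obtain ⟨i, hi⟩ := hex v₀ hv₀
  -- The last `i` is a junk value; it is not used for components that avoid `Z`.
  let cls : H.ConnectedComponent → Fin d := fun c =>
    if (Γ i).Mem (G.induce c.supp) then i
    else if h : ∃ j, (Γ j).Mem (G.induce c.supp) then h.choose else i
  have hcls : ∀ v ∉ Z, (Γ (cls (H.connectedComponentMk v))).Mem
      (G.induce (H.connectedComponentMk v).supp) := fun v hv => by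
    by_cases h₁ : (Γ i).Mem (G.induce (H.connectedComponentMk v).supp)
    · simpa only [cls, if_pos h₁] using h₁
    · simpa only [cls, if_neg h₁, dif_pos (hex v hv)] using (hex v hv).choose_spec
  let lab : Fin n → Option (Fin d) := fun v =>
    if v ∈ Z then none else some (cls (H.connectedComponentMk v))
  have hlabn : ∀ v, lab v = none ↔ v ∈ Z := fun v => by simp [lab]
  have hlabs : ∀ v, v ∉ Z → lab v = some (cls (H.connectedComponentMk v)) := fun v hv => by
    simp [lab, hv]
  have hadj : ∀ u v, G.Adj u v → u ∉ Z → v ∉ Z →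
      H.connectedComponentMk u = H.connectedComponentMk v := fun u v huv hu hv =>
    SimpleGraph.ConnectedComponent.sound
      (SimpleGraph.Adj.reachable (⟨huv, hu, hv⟩ : H.Adj u v))
  refine ⟨i, lab, ⟨⟨?_, ?_, ?_⟩, ?_, ?_⟩⟩
  · simpa [hlabn] using hZ
  · intro u v huv
    by_cases hu : u ∈ Z
    · exact .inl ((hlabn u).2 hu)
    by_cases hv : v ∈ Z
    · exact .inr (.inl ((hlabn v).2 hv))
    · rw [hlabs u hu, hlabs v hv, hadj u v huv hu hv]
      exact .inr (.inr rfl)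
  · intro j S hS hc
    obtain ⟨v, hv⟩ := hc.nonempty
    have hnZ : ∀ u ∈ S, u ∉ Z := fun u hu hZ => by
      have := hS hu
      simp [(hlabn u).2 hZ] at this
    have hSc : S ⊆ (H.connectedComponentMk v).supp := fun u hu =>
      connected_propagate hc (P := fun u => u ∈ (H.connectedComponentMk v).supp)
        (fun a ha b hb hab hP => by
          rw [SimpleGraph.ConnectedComponent.mem_supp_iff] at hP ⊢
          rw [← hP, hadj a b hab (hnZ a ha) (hnZ b hb)]) hv hu rfl
    have hvj : cls (H.connectedComponentMk v) = j := by
      have := hS hv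
      simpa [hlabs v (hnZ v hv)] using this
    exact ⟨(), GraphClass.IsHereditary.mem_of_embedding (hΓ j) (SimpleGraph.induceHomOfLE G hSc)
      (hvj ▸ hcls v (hnZ v hv))⟩
  · refine le_trans (Finset.card_le_card fun v hv => ?_) hcard
    simp only [Finset.mem_filter, Finset.mem_univ, true_and, ne_eq, hlabn] at hv ⊢
    refine ⟨hv.1, fun hc => hv.2 ?_⟩
    rw [hlabs v hv.1, (SimpleGraph.ConnectedComponent.mem_supp_iff _ _).1 hc]
    simp only [cls, if_pos hi]
  · intro v hvn hvi
    have hvZ : v ∉ Z := fun h => hvn ((hlabn v).2 h)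
    refine ⟨(H.connectedComponentMk v).supp, rfl, hconn _, fun u hu => ?_, fun hm => hvi ?_⟩
    · rw [hlabs v hvZ, hlabs u (hsub v hvZ u hu),
        (SimpleGraph.ConnectedComponent.mem_supp_iff _ _).1 hu]
    · rw [hlabs v hvZ]
      simp only [cls, if_pos hm]

end Labelling

/-! ## The algorithm -/

/-- Graphs on `{0, …, n - 1}` for some `n`. -/
abbrev Gr : Type := Σ n : ℕ, SimpleGraph (Fin n)

namespace Gr

open Classical in
/-- The adjacency matrix. -/
noncomputable def rows (g : Gr) : List (List Bool) :=
  List.ofFn fun i : Fin g.1 => List.ofFn fun j : Fin g.1 => decide (g.2.Adj i j)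

/-- The adjacency relation, on numbers. -/
noncomputable def adj (g : Gr) (u v : ℕ) : Bool := (g.rows.getD u []).getD v false

theorem adj_iff (g : Gr) (u v : ℕ) :
    g.adj u v = true ↔ ∃ (hu : u < g.1) (hv : v < g.1), g.2.Adj ⟨u, hu⟩ ⟨v, hv⟩ := by
  by_cases hu : u < g.1
  · by_cases hv : v < g.1
    · simp [adj, rows, List.getD_eq_getElem?_getD, hu, hv]
    · simp [adj, rows, List.getD_eq_getElem?_getD, hu, hv]
  · simp [adj, rows, List.getD_eq_getElem?_getD, hu]

theorem adj_fin {n : ℕ} (G : SimpleGraph (Fin n)) (u v : Fin n) :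
    adj ⟨n, G⟩ u v = true ↔ G.Adj u v := by
  simp [adj_iff]

/-- The graph induced by a list of vertices. -/
noncomputable def sub (g : Gr) (vs : List ℕ) : Gr :=
  ⟨vs.length, { Adj := fun i j => g.adj vs[i] vs[j] = true
                symm := ⟨fun i j h => by
                  obtain ⟨hu, hv, h⟩ := (g.adj_iff _ _).1 h
                  exact (g.adj_iff _ _).2 ⟨hv, hu, h.symm⟩⟩
                loopless := ⟨fun i h => by
                  obtain ⟨hu, hv, h⟩ := (g.adj_iff _ _).1 h
                  exact h.ne rfl⟩ }⟩

theorem rows_sub (g : Gr) (vs : List ℕ) :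
    (g.sub vs).rows = vs.map fun u => vs.map fun v => g.adj u v := by
  apply List.ext_getElem
  · simp [rows, sub]
  · intro i h₁ h₂
    apply List.ext_getElem
    · simp [rows, sub]
    · intro j h₃ h₄
      simp only [rows, sub, List.getElem_ofFn, List.getElem_map, Fin.getElem_fin]
      exact Bool.eq_iff_iff.2 (@decide_eq_true_iff _ (Classical.propDecidable _))

end Gr

open Classical in
/-- Decides the problem of vertex deletion to a single class. -/
noncomputable def solve (Γ : GraphClass) (g : Gr) (k : ℕ) : Bool :=
  decide (VertexDeletion (fun _ : Unit => Γ) g.1 g.2 k)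

theorem length_filter_range {n : ℕ} (P : ℕ → Bool) :
    ((List.range n).filter P).length = (Finset.univ.filter fun v : Fin n => P v = true).card := by
  rw [← List.toFinset_card_of_nodup (List.nodup_range.filter _),
    ← Finset.card_map Fin.valEmbedding]
  congr 1
  ext v
  simp only [List.mem_toFinset, List.mem_filter, List.mem_range, Finset.mem_map, Finset.mem_filter,
    Finset.mem_univ, true_and, Fin.valEmbedding_apply]
  constructor
  · rintro ⟨h₁, h₂⟩
    exact ⟨⟨v, h₁⟩, h₂, rfl⟩
  · rintro ⟨u, h, rfl⟩
    exact ⟨u.2, h⟩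

theorem solve_sub_filter_iff {Γ : GraphClass} (hΓ : Γ.IsHereditary) {n : ℕ}
    (G : SimpleGraph (Fin n)) (P : ℕ → Bool) (k : ℕ) :
    solve Γ (Gr.sub ⟨n, G⟩ ((List.range n).filter P)) k = true ↔
      ∃ Z : Finset (Fin n), Z.card ≤ k ∧
        ConnectedIn (fun _ : Unit => Γ) G {v | P v = true ∧ v ∉ Z} := by
  set vs := (List.range n).filter P with hvs
  have hmem : ∀ i : Fin vs.length, vs[i] < n ∧ P vs[i] = true := fun i => by
    have : vs[i] ∈ vs := List.getElem_mem i.2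
    simpa only [hvs, List.mem_filter, List.mem_range] using this
  have hnd : vs.Nodup := List.nodup_range.filter _
  let f : Fin vs.length ↪ Fin n := ⟨fun i => ⟨vs[i], (hmem i).1⟩, fun i j hij => by
    have : vs[i] = vs[j] := congrArg Fin.val hij
    exact Fin.ext ((List.Nodup.getElem_inj_iff hnd).1 this)⟩
  have hG : (Gr.sub ⟨n, G⟩ vs).2 = G.comap f := by
    ext i j
    change Gr.adj ⟨n, G⟩ vs[i] vs[j] = true ↔ G.Adj (f i) (f j)
    exact Gr.adj_fin G (f i) (f j)
  have hr : Set.range f = {v : Fin n | P v = true} := by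
    ext v
    constructor
    · rintro ⟨i, rfl⟩
      exact (hmem i).2
    · intro hv
      have : (v : ℕ) ∈ vs := List.mem_filter.2 ⟨List.mem_range.2 v.2, hv⟩
      obtain ⟨i, hi, h⟩ := List.getElem_of_mem this
      exact ⟨⟨i, hi⟩, Fin.ext h⟩
  have := vertexDeletion_comap_iff (Γ := fun _ : Unit => Γ) (fun _ => hΓ) G f k
  rw [hr, ← hG] at this
  exact (@decide_eq_true_iff _ (Classical.propDecidable _)).trans this

/-! ### A modulator by self-reduction -/

/-- Adds the vertex `v` to `M` if this can be extended to a modulator of size `T`. -/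
noncomputable def modStep (Γ : GraphClass) (g : Gr) (T : ℕ) (M : List ℕ) (v : ℕ) : List ℕ :=
  if decide (M.length + 1 ≤ T) && solve Γ (g.sub ((List.range g.1).filter fun u =>
    !(v :: M).any fun w => decide (w = u))) (T - (M.length + 1)) then v :: M else M

/-- A set of at most `T` vertices whose removal leaves only components in the class, if there is
one. -/
noncomputable def modulator (Γ : GraphClass) (g : Gr) (T : ℕ) : List ℕ :=
  (List.range g.1).foldl (modStep Γ g T) []

/-- `M` can be extended to a modulator of size `T`. -/
def Extendable (Γ : GraphClass) {n : ℕ} (G : SimpleGraph (Fin n)) (T : ℕ) (M : List ℕ) : Prop :=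
  ∃ Z : Finset (Fin n), Z.card + M.length ≤ T ∧
    ConnectedIn (fun _ : Unit => Γ) G {v | (v : ℕ) ∉ M ∧ v ∉ Z}

/-- The vertex `a` moves from the list to the set that extends it. Consequently a vertex rejected
once stays rejected when the list grows. -/
theorem Extendable.of_cons_cons {Γ : GraphClass} {n : ℕ} {G : SimpleGraph (Fin n)} {T : ℕ}
    {M : List ℕ} {u a : ℕ} (ha : a < n) (h : Extendable Γ G T (u :: a :: M)) :
    Extendable Γ G T (u :: M) := by
  obtain ⟨Z, hZ, h⟩ := h
  refine ⟨insert ⟨a, ha⟩ Z, ?_, h.mono fun v hv => ?_⟩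
  · have := Finset.card_insert_le (⟨a, ha⟩ : Fin n) Z
    simp only [List.length_cons] at hZ ⊢
    omega
  · simp only [Set.mem_ofPred_eq, List.mem_cons, Finset.mem_insert, not_or, Fin.ext_iff] at hv ⊢
    tauto

theorem modStep_eq {Γ : GraphClass} (hΓ : Γ.IsHereditary) {n : ℕ} (G : SimpleGraph (Fin n)) (T : ℕ)
    (M : List ℕ) (v : ℕ) [Decidable (Extendable Γ G T (v :: M))] :
    modStep Γ ⟨n, G⟩ T M v = if Extendable Γ G T (v :: M) then v :: M else M := by
  unfold modStep
  congr 1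
  rw [eq_iff_iff, Bool.and_eq_true, decide_eq_true_iff, solve_sub_filter_iff hΓ]
  have hset : ∀ Z : Finset (Fin n), {u : Fin n | (!(v :: M).any fun w => decide (w = (u : ℕ))) = true
      ∧ u ∉ Z} = {u : Fin n | (u : ℕ) ∉ v :: M ∧ u ∉ Z} := fun Z => by
    ext u
    simp only [Set.mem_ofPred_eq, Bool.not_eq_true', List.any_eq_false, decide_eq_true_eq]
    refine and_congr_left fun _ => ⟨fun h hu => h _ hu rfl, fun h w hw e => h (e ▸ hw)⟩
  simp only [hset, Extendable, List.length_cons]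
  constructor
  · rintro ⟨hT, Z, hZ, h⟩
    exact ⟨Z, by omega, h⟩
  · rintro ⟨Z, hZ, h⟩
    exact ⟨by omega, Z, by omega, h⟩

open Classical in
-- Greedy choice keeps the list extendable, and in the end every vertex that could still be added is
-- already in it.
theorem modulator_spec {Γ : GraphClass} (hΓ : Γ.IsHereditary) {n : ℕ} (G : SimpleGraph (Fin n))
    {T : ℕ} (h : Extendable Γ G T []) :
    (modulator Γ ⟨n, G⟩ T).length ≤ T ∧
      ConnectedIn (fun _ : Unit => Γ) G {v | (v : ℕ) ∉ modulator Γ ⟨n, G⟩ T} := by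
  have key : ∀ N ≤ n, Extendable Γ G T ((List.range N).foldl (modStep Γ ⟨n, G⟩ T) []) ∧
      ∀ u < N, Extendable Γ G T (u :: (List.range N).foldl (modStep Γ ⟨n, G⟩ T) []) →
        u ∈ (List.range N).foldl (modStep Γ ⟨n, G⟩ T) [] := by
    intro N
    induction N with
    | zero => intro _; exact ⟨by simpa using h, by simp⟩
    | succ N ih =>
      intro hN
      obtain ⟨h₁, h₂⟩ := ih (by omega)
      rw [List.range_succ, List.foldl_append, List.foldl_cons, List.foldl_nil, modStep_eq hΓ]
      split_ifs with hext
      · refine ⟨hext, fun u hu hu' => ?_⟩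
        rcases Nat.lt_succ_iff_lt_or_eq.1 hu with hu | rfl
        · exact List.mem_cons_of_mem _ (h₂ u hu (hu'.of_cons_cons (by omega)))
        · exact List.mem_cons_self
      · refine ⟨h₁, fun u hu hu' => ?_⟩
        rcases Nat.lt_succ_iff_lt_or_eq.1 hu with hu | rfl
        · exact h₂ u hu hu'
        · exact absurd hu' hext
  obtain ⟨⟨Z, hZ, hc⟩, h₂⟩ := key n le_rfl
  refine ⟨by unfold modulator; dsimp only; omega, hc.mono fun v hv => ⟨hv, fun hvZ => hv ?_⟩⟩
  -- A vertex of the extending set `Z` could itself be added, so it is already in the list; thus `Z`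
  -- contributes nothing.
  refine h₂ v v.2 ⟨Z.erase v, ?_, hc.mono fun u hu => ?_⟩
  · have := Finset.card_erase_add_one hvZ
    simp only [List.length_cons]
    omega
  · simp only [Set.mem_ofPred_eq, List.mem_cons, Finset.mem_erase, not_or] at hu ⊢
    tauto

/-! ### Branching over partial labellings -/

section Branching

variable {d : ℕ}

/-- The label of `v`; the label `i` if there is none. -/
def labelOf (i : Fin d) (l : List (ℕ × Option (Fin d))) (v : ℕ) : Option (Fin d) :=
  l.foldl (fun s e => if decide (e.1 = v) then e.2 else s) (some i)

/-- `v` has a label. -/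
def isLabelled (l : List (ℕ × Option (Fin d))) (v : ℕ) : Bool := l.any fun e => decide (e.1 = v)

/-- `v` has no label, and it is in `M` or adjacent to a vertex labelled by a class other
than `i`. -/
noncomputable def isPending (i : Fin d) (g : Gr) (M : List ℕ) (l : List (ℕ × Option (Fin d)))
    (v : ℕ) : Bool :=
  !isLabelled l v && (M.any (fun w => decide (w = v)) || (List.range g.1).any fun u =>
    g.adj u v && (!decide (labelOf i l u = none) && !decide (labelOf i l u = some i)))

/-- All labels. -/
def labels (d : ℕ) : List (Option (Fin d)) := none :: (List.finRange d).map some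

/-- Extends the labelling by one vertex in all ways. -/
noncomputable def expand (i : Fin d) (g : Gr) (M : List ℕ) (l : List (ℕ × Option (Fin d))) :
    List (List (ℕ × Option (Fin d))) :=
  match (List.range g.1).filter (isPending i g M l) with
  | [] => [l]
  | v :: _ => (labels d).map fun a => (v, a) :: l

/-- The partial labellings reached after as many rounds as `r` has elements. -/
noncomputable def branches (i : Fin d) (g : Gr) (M : List ℕ) (r : List Unit) :
    List (List (ℕ × Option (Fin d))) :=
  r.foldl (fun S _ => S.flatMap (expand i g M)) [[]]

/-- Decides whether the labelling is a solution, up to deletions in the class `i`. -/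
noncomputable def check (Γ : Fin d → GraphClass) (i : Fin d) (g : Gr) (k : ℕ)
    (l : List (ℕ × Option (Fin d))) : Bool :=
  decide (((List.range g.1).filter fun v => decide (labelOf i l v = none)).length ≤ k) &&
  ((List.range g.1).all (fun u => (List.range g.1).all fun v => !g.adj u v ||
    (decide (labelOf i l u = none) || (decide (labelOf i l v = none) ||
      decide (labelOf i l u = labelOf i l v)))) &&
  decide (∀ j : Fin d, solve (Γ j)
    (g.sub ((List.range g.1).filter fun v => decide (labelOf i l v = some j)))
    (if j = i then k - ((List.range g.1).filter fun v => decide (labelOf i l v = none)).length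
      else 0) = true))

/-- The search for a solution all of whose classes but `i` are small. -/
noncomputable def search (Γ : Fin d → GraphClass) (i : Fin d) (g : Gr) (k T : ℕ) : Bool :=
  (branches i g (modulator (Γ i) g T) (List.replicate T () ++ List.replicate T ())).any
    (check Γ i g k)

/-- The algorithm. -/
noncomputable def algorithm (Γ : Fin d → GraphClass) (g : Gr) (k T : ℕ) : Bool :=
  decide (g.1 ≤ k) || decide (∃ i, search Γ i g k T = true)

/-- Soundness does not depend on unbreakability: the deletions found in class `i` are added to the
deleted vertices of the labelling. -/
theorem vertexDeletion_of_check {Γ : Fin d → GraphClass} (hΓ : ∀ i, (Γ i).IsHereditary) {n : ℕ}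
    {G : SimpleGraph (Fin n)} {k : ℕ} {i : Fin d} {l : List (ℕ × Option (Fin d))}
    (h : check Γ i ⟨n, G⟩ k l = true) : VertexDeletion Γ n G k := by
  simp only [check, Bool.and_eq_true, decide_eq_true_eq, solve_sub_filter_iff (hΓ _),
    length_filter_range, List.all_eq_true, List.mem_range, Bool.or_eq_true, Bool.not_eq_true'] at h
  obtain ⟨hk, hadj, hsol⟩ := h
  obtain ⟨Z, hZ, hi⟩ := hsol i
  rw [if_pos rfl] at hZ
  refine IsSolution.vertexDeletion hΓ (lab := fun v => if v ∈ Z then none else labelOf i l v)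
    ⟨?_, ?_, ?_⟩
  · refine le_trans (Finset.card_le_card (t := (Finset.univ.filter fun v : Fin n =>
      labelOf i l v = none) ∪ Z) fun v hv => ?_) ((Finset.card_union_le _ _).trans (by omega))
    simp only [Finset.mem_filter, Finset.mem_univ, true_and, Finset.mem_union] at hv ⊢
    by_cases hvZ : v ∈ Z
    · exact .inr hvZ
    · exact .inl (by simpa [hvZ] using hv)
  · intro u v huv
    have := hadj u u.2 v v.2
    rw [← Bool.not_eq_true, Gr.adj_fin] at this
    by_cases hu : u ∈ Z
    · simp [hu]
    by_cases hv : v ∈ Z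
    · simp [hv]
    simp only [if_neg hu, if_neg hv]
    exact this.resolve_left (not_not.2 huv)
  · intro j
    by_cases hj : j = i
    · subst hj
      refine hi.mono fun v hv => ?_
      by_cases hvZ : v ∈ Z <;> simp_all
    · obtain ⟨Z', hZ', hj'⟩ := hsol j
      rw [if_neg hj, Nat.le_zero, Finset.card_eq_zero] at hZ'
      subst hZ'
      refine hj'.mono fun v hv => ?_
      by_cases hvZ : v ∈ Z <;> simp_all

theorem labelOf_eq {n : ℕ} {i : Fin d} {lab : Fin n → Option (Fin d)}
    {l : List (ℕ × Option (Fin d))} (hl : ∀ e ∈ l, ∃ h : e.1 < n, e.2 = lab ⟨e.1, h⟩) (v : Fin n) :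
    labelOf i l v = if isLabelled l v then lab v else some i := by
  have key : ∀ (l : List (ℕ × Option (Fin d))) (s : Option (Fin d)),
      (∀ e ∈ l, ∃ h : e.1 < n, e.2 = lab ⟨e.1, h⟩) →
      l.foldl (fun s e => if decide (e.1 = (v : ℕ)) then e.2 else s) s =
        if isLabelled l v then lab v else s := by
    intro l
    induction l with
    | nil => simp [isLabelled]
    | cons e l ih =>
      intro s hs
      rw [List.foldl_cons, ih _ fun e he => hs e (List.mem_cons_of_mem _ he)]
      obtain ⟨h, he⟩ := hs e List.mem_cons_self
      by_cases hv : e.1 = v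
      · have : (⟨e.1, h⟩ : Fin n) = v := Fin.ext hv
        rw [this] at he
        simp [isLabelled, hv, he]
      · simp [isLabelled, hv]
  exact key l _ hl

theorem isLabelled_iff {l : List (ℕ × Option (Fin d))} {v : ℕ} :
    isLabelled l v = true ↔ v ∈ l.map Prod.fst := by
  simp [isLabelled]

/-- Follow the branch that always guesses `lab`. A pending vertex is in `M` or next to a vertex
labelled by a class other than `i`; in the second case `lab` gives it that class or deletes it. So
all labelled vertices lie in `M` or have `lab v ≠ some i`, and there are too few of these for every
round to label a new one with something still pending at the end. -/
theorem exists_mem_branches {n : ℕ} {G : SimpleGraph (Fin n)} {i : Fin d} {M : List ℕ}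
    {lab : Fin n → Option (Fin d)}
    (hadj : ∀ u v, G.Adj u v → lab u = none ∨ lab v = none ∨ lab u = lab v) (r : List Unit)
    (hr : M.length + (Finset.univ.filter fun v => lab v ≠ some i).card ≤ r.length) :
    ∃ l ∈ branches i ⟨n, G⟩ M r, (∀ e ∈ l, ∃ h : e.1 < n, e.2 = lab ⟨e.1, h⟩) ∧
      ∀ v : Fin n, isPending i ⟨n, G⟩ M l v = false := by
  set U : Finset ℕ := M.toFinset ∪
    (Finset.univ.filter fun v => lab v ≠ some i).map Fin.valEmbedding with hU
  have hUcard : U.card ≤ r.length := by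
    refine (Finset.card_union_le _ _).trans (le_trans ?_ hr)
    rw [Finset.card_map]
    exact Nat.add_le_add_right (List.toFinset_card_le M) _
  have hpend : ∀ l : List (ℕ × Option (Fin d)), (∀ e ∈ l, ∃ h : e.1 < n, e.2 = lab ⟨e.1, h⟩) →
      ∀ v : Fin n, isPending i ⟨n, G⟩ M l v = true → (v : ℕ) ∈ U ∧ (v : ℕ) ∉ l.map Prod.fst := by
    intro l hl v hv
    simp only [isPending, Bool.and_eq_true, Bool.not_eq_true', Bool.or_eq_true, List.any_eq_true,
      decide_eq_true_eq, decide_eq_false_iff_not, List.mem_range] at hv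
    obtain ⟨hv₁, hv₂⟩ := hv
    refine ⟨?_, fun h => by rw [isLabelled_iff.2 h] at hv₁; exact Bool.noConfusion hv₁⟩
    rw [hU, Finset.mem_union]
    rcases hv₂ with ⟨w, hw, rfl⟩ | ⟨u, hu, huv, h₁, h₂⟩
    · exact .inl (List.mem_toFinset.2 hw)
    · right
      have huv' := (Gr.adj_fin G ⟨u, hu⟩ v).1 huv
      rw [labelOf_eq hl ⟨u, hu⟩] at h₁ h₂
      split_ifs at h₁ h₂ with hlab
      · refine Finset.mem_map.2 ⟨v, ?_, rfl⟩
        simp only [Finset.mem_filter, Finset.mem_univ, true_and]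
        intro hvi
        rcases hadj _ _ huv' with h | h | h
        · exact h₁ h
        · simp [hvi] at h
        · exact h₂ (h.trans hvi)
      · exact absurd rfl h₂
  -- Either nothing is pending any more, or every round so far has labelled a new vertex of `U`.
  have key : ∀ r : List Unit, ∃ l ∈ branches i ⟨n, G⟩ M r,
      (∀ e ∈ l, ∃ h : e.1 < n, e.2 = lab ⟨e.1, h⟩) ∧ (∀ u ∈ l.map Prod.fst, u ∈ U) ∧
      (l.map Prod.fst).Nodup ∧
      ((∀ v : Fin n, isPending i ⟨n, G⟩ M l v = false) ∨ l.length = r.length) := by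
    intro r
    induction r using List.reverseRecOn with
    | nil => exact ⟨[], by simp [branches], by simp, by simp, by simp, .inr rfl⟩
    | append_singleton r a ih =>
      obtain ⟨l, hlm, hl, hlU, hnd, hor⟩ := ih
      have hb : branches i ⟨n, G⟩ M (r ++ [a]) =
          (branches i ⟨n, G⟩ M r).flatMap (expand i ⟨n, G⟩ M) := by simp [branches]
      rw [hb]
      cases hf : (List.range n).filter (isPending i ⟨n, G⟩ M l) with
      | nil =>
        refine ⟨l, List.mem_flatMap.2 ⟨l, hlm, by simp [expand, hf]⟩, hl, hlU, hnd, .inl ?_⟩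
        intro v
        by_contra hv
        have : (v : ℕ) ∈ (List.range n).filter (isPending i ⟨n, G⟩ M l) :=
          List.mem_filter.2 ⟨List.mem_range.2 v.2, by simpa using hv⟩
        simp [hf] at this
      | cons v vs =>
        have hv : v ∈ (List.range n).filter (isPending i ⟨n, G⟩ M l) := by simp [hf]
        obtain ⟨hvn, hvp⟩ := List.mem_filter.1 hv
        rw [List.mem_range] at hvn
        obtain ⟨hvU, hvl⟩ := hpend l hl ⟨v, hvn⟩ hvp
        refine ⟨(v, lab ⟨v, hvn⟩) :: l, List.mem_flatMap.2 ⟨l, hlm, ?_⟩, ?_, ?_, ?_, .inr ?_⟩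
        · simp only [expand, hf]
          refine List.mem_map.2 ⟨lab ⟨v, hvn⟩, ?_, rfl⟩
          cases lab ⟨v, hvn⟩ <;> simp [labels]
        · rintro e he
          rcases List.mem_cons.1 he with rfl | he
          · exact ⟨hvn, rfl⟩
          · exact hl e he
        · rintro u hu
          rcases List.mem_cons.1 hu with rfl | hu
          · exact hvU
          · exact hlU u hu
        · exact List.nodup_cons.2 ⟨hvl, hnd⟩
        · rcases hor with h | h
          · have := h ⟨v, hvn⟩
            rw [hvp] at this
            exact Bool.noConfusion this
          · simp [h]
  obtain ⟨l, hlm, hl, hlU, hnd, hor⟩ := key r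
  refine ⟨l, hlm, hl, hor.elim (fun h => h) fun hlen v => ?_⟩
  by_contra hv
  obtain ⟨hvU, hvl⟩ := hpend l hl v (by simpa using hv)
  -- A vertex still pending would give `r.length + 1` distinct elements of `U`.
  have : ((v : ℕ) :: l.map Prod.fst).toFinset ⊆ U := fun u hu => by
    rcases List.mem_cons.1 (List.mem_toFinset.1 hu) with rfl | hu
    · exact hvU
    · exact hlU u hu
  have := Finset.card_le_card this
  rw [List.toFinset_card_of_nodup (List.nodup_cons.2 ⟨hvl, hnd⟩)] at this
  simp at this
  omega

/-- On the branch that agrees with `lab`, all vertices of classes other than `i` are labelled, so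
only deletions hidden among the vertices with default label `i` remain to be found. -/
theorem IsSmallSolution.search_eq_true {Γ : Fin d → GraphClass} (hΓ : ∀ i, (Γ i).IsHereditary)
    {n : ℕ} {G : SimpleGraph (Fin n)} {k r T : ℕ} {i : Fin d} {lab : Fin n → Option (Fin d)}
    (h : IsSmallSolution Γ G k r i lab) (hT : k + r ≤ T) : search Γ i ⟨n, G⟩ k T = true := by
  have hcard : (Finset.univ.filter fun v => lab v ≠ some i).card ≤ T := by
    refine le_trans (Finset.card_le_card (t := (Finset.univ.filter fun v => lab v = none) ∪
      Finset.univ.filter fun v => lab v ≠ none ∧ lab v ≠ some i) fun v hv => ?_)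
      ((Finset.card_union_le _ _).trans ((Nat.add_le_add h.card_le h.card_other_le).trans hT))
    simp only [Finset.mem_filter, Finset.mem_univ, true_and, Finset.mem_union] at hv ⊢
    tauto
  -- The vertices not labelled `i` show that a modulator of size `T` exists. The computed `M` may be
  -- a different one.
  obtain ⟨hMlen, hM⟩ := modulator_spec (hΓ i) G (T := T)
    ⟨Finset.univ.filter fun v => lab v ≠ some i, by simpa using hcard,
      (h.mem i).mono fun v hv => by simpa using hv⟩
  set M := modulator (Γ i) ⟨n, G⟩ T with hMdef
  obtain ⟨l, hlm, hl, hpend⟩ := exists_mem_branches (i := i) (M := M) h.adj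
    (List.replicate T () ++ List.replicate T ()) (by
      rw [List.length_append, List.length_replicate]; omega)
  refine List.any_eq_true.2 ⟨l, hlm, ?_⟩
  have heff := labelOf_eq (i := i) hl
  have hMl : ∀ v : Fin n, (v : ℕ) ∈ M → isLabelled l v = true := fun v hv => by
    by_contra hnl
    have := hpend v
    simp only [isPending, Bool.and_eq_false_iff, Bool.not_eq_false', Bool.or_eq_false_iff,
      List.any_eq_false, decide_eq_true_eq] at this
    exact this.elim hnl fun h => h.1 v hv rfl
  have hstep : ∀ u v : Fin n, G.Adj u v → isLabelled l u = true → lab u ≠ none →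
      lab u ≠ some i → isLabelled l v = true := fun u v huv hu hun hui => by
    by_contra hnl
    have := hpend v
    simp only [isPending, Bool.and_eq_false_iff, Bool.not_eq_false', Bool.or_eq_false_iff,
      List.any_eq_false] at this
    refine (this.resolve_left hnl).2 u (List.mem_range.2 u.2) ?_
    simp [heff, hu, hun, hui, Gr.adj_fin, huv]
  -- The connected set around `v` is not in class `i`, so it meets `M`. From there the labels spread
  -- over all of it, since nothing is pending.
  have hother : ∀ v, lab v ≠ none → lab v ≠ some i → isLabelled l v = true := by
    intro v hvn hvi
    obtain ⟨S, hvS, hc, hlabS, hnm⟩ := h.exists_not_mem v hvn hvi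
    have : ∃ m ∈ S, (m : ℕ) ∈ M := by
      by_contra! hcon
      exact hnm (hM S hcon hc).choose_spec
    obtain ⟨m, hmS, hmM⟩ := this
    refine connected_propagate hc (P := fun u => isLabelled l u = true)
      (fun a ha b _ hab hPa => hstep a b hab hPa ?_ ?_) hmS hvS (hMl m hmM)
    · rwa [hlabS a ha]
    · rwa [hlabS a ha]
  have hnone : ∀ v : Fin n, labelOf i l v = none ↔ isLabelled l v = true ∧ lab v = none :=
    fun v => by rw [heff]; split_ifs with hv <;> simp [hv]
  have hsub : (Finset.univ.filter fun v : Fin n => labelOf i l v = none) ⊆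
      Finset.univ.filter fun v => lab v = none := fun v hv => by
    simp only [Finset.mem_filter, Finset.mem_univ, true_and, hnone] at hv ⊢
    exact hv.2
  simp only [check, Bool.and_eq_true, decide_eq_true_eq, solve_sub_filter_iff (hΓ _),
    length_filter_range, List.all_eq_true, List.mem_range, Bool.or_eq_true, Bool.not_eq_true']
  refine ⟨(Finset.card_le_card hsub).trans h.card_le, fun u hu v hv => ?_, fun j => ?_⟩
  · lift u to Fin n using hu
    lift v to Fin n using hv
    rw [← Bool.not_eq_true, Gr.adj_fin]
    by_cases huv : G.Adj u v
    · right
      have h₁ := hstep u v huv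
      have h₂ := hstep v u huv.symm
      have h₃ := h.adj u v huv
      rw [heff, heff]
      by_cases hu : isLabelled l u = true <;> by_cases hv : isLabelled l v = true
      · simpa [hu, hv] using h₃
      · rw [if_pos hu, if_neg hv]
        by_contra! hcon
        exact hv (h₁ hu hcon.1 hcon.2.2)
      · rw [if_neg hu, if_pos hv]
        by_contra! hcon
        exact hu (h₂ hv hcon.2.1 (Ne.symm hcon.2.2))
      · simp [hu, hv]
    · exact .inl huv
  · by_cases hj : j = i
    · subst hj
      rw [if_pos rfl]
      -- These are the deleted vertices that the branch has not labelled; their number is within the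
      -- remaining budget.
      refine ⟨(Finset.univ.filter fun v => lab v = none) \
        Finset.univ.filter fun v : Fin n => labelOf j l v = none, ?_, (h.mem j).mono fun v hv => ?_⟩
      · rw [Finset.card_sdiff_of_subset hsub]
        exact Nat.sub_le_sub_right h.card_le _
      · simp only [Set.mem_ofPred_eq, Finset.mem_sdiff, Finset.mem_filter, Finset.mem_univ, true_and,
          not_and, not_not] at hv ⊢
        by_contra hvj
        by_cases hvn : lab v = none
        · have := hv.2 hvn
          rw [hv.1] at this
          simp at this
        · have := hother v hvn hvj
          rw [heff, if_pos this] at hv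
          exact hvj hv.1
    · rw [if_neg hj]
      -- The default label is `i`, so a vertex with label `j` was labelled explicitly and in
      -- accordance with `lab`.
      refine ⟨∅, by simp, (h.mem j).mono fun v hv => ?_⟩
      have hv' := hv.1
      rw [heff] at hv'
      split_ifs at hv' with hvl
      · exact hv'
      · exact absurd (Option.some.inj hv').symm hj

theorem algorithm_eq_true_iff {Γ : Fin d → GraphClass} (hΓ : ∀ i, (Γ i).IsHereditary) {n : ℕ}
    {G : SimpleGraph (Fin n)} {s k T : ℕ} (hG : IsUnbreakable G s k) (hT : k + 3 * s ≤ T) :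
    algorithm Γ ⟨n, G⟩ k T = true ↔ VertexDeletion Γ n G k := by
  simp only [algorithm, Bool.or_eq_true, decide_eq_true_eq]
  constructor
  · rintro (h | ⟨i, h⟩)
    · refine (vertexDeletion_iff hΓ G k).2 ⟨Finset.univ, by simpa using h, fun S hS hc => ?_⟩
      obtain ⟨v, hv⟩ := hc.nonempty
      simpa using hS hv
    · obtain ⟨l, -, hl⟩ := List.any_eq_true.1 h
      exact vertexDeletion_of_check hΓ hl
  · intro h
    by_cases hn : n ≤ k
    · exact .inl hn
    · obtain ⟨i, lab, hlab⟩ := exists_isSmallSolution hΓ hG (by omega) h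
      exact .inr ⟨i, hlab.search_eq_true hΓ hT⟩

end Branching

/-! ## Running time of the algorithm -/

noncomputable instance : Enc Gr := ⟨fun g => enc g.rows, fun g => mu g.rows⟩

/-- The number that encodes a label. -/
def labelCode {d : ℕ} : Option (Fin d) → ℕ
  | none => 0
  | some j => j + 1

theorem labelCode_injective {d : ℕ} : Function.Injective (labelCode (d := d)) := by
  rintro (_ | a) (_ | b) h <;> simp_all [labelCode, Fin.ext_iff]

instance {d : ℕ} : Enc (Option (Fin d)) := ⟨fun a => enc (labelCode a), fun a => mu (labelCode a)⟩

theorem mu_label_le {d : ℕ} (a : Option (Fin d)) : mu a ≤ 2 * d + 1 := by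
  change 2 * labelCode a + 1 ≤ _
  rcases a with _ | a <;> simp [labelCode]

theorem encodeGraph_eq {n : ℕ} (G : SimpleGraph (Fin n)) :
    encodeGraph G = enc (⟨n, G⟩ : Gr) := by
  change _ = Data.ofList (List.map (fun l => Data.ofList (List.map Data.ofBool l)) (Gr.rows ⟨n, G⟩))
  simp only [encodeGraph, Gr.rows, List.map_ofFn, Function.comp_def]

theorem size_enc_list {α : Type} [Enc α] (h : ∀ a : α, (enc a).size = mu a) (l : List α) :
    (enc l).size = mu l := by
  induction l with
  | nil => rfl
  | cons a l ih => simp [Data.size, h, ih]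

theorem size_encodeGraph {n : ℕ} (G : SimpleGraph (Fin n)) :
    (encodeGraph G).size = mu (⟨n, G⟩ : Gr) := by
  rw [encodeGraph_eq]
  exact size_enc_list (fun l => size_enc_list (fun b => rfl) l) _

/-- The problem of vertex deletion to the class is solved in time polynomial in the measure of the
input and in the value of `F` at the parameter. -/
def Solvable (Γ : GraphClass) (F : ℕ → ℕ) : Prop :=
  ∀ {α : Type} [Enc α] {gr : α → Gr} {kk : α → ℕ}, PolyTime gr → PolyTime kk →
    PolyBdd (fun a => F (kk a)) → PolyTime fun a => solve Γ (gr a) (kk a)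

/-- The time `f k * |G| ^ c` is polynomial wherever the measure of the input controls `f k`. -/
theorem FPT.exists_solvable {Γ : GraphClass} (h : FPT (VertexDeletion fun _ : Unit => Γ)) :
    ∃ f : ℕ → ℕ, Computable f ∧ Solvable Γ f := by
  obtain ⟨p, f, c, hf, h⟩ := h
  refine ⟨f, hf, fun {α} _ {gr kk} hgr hkk hF => ?_⟩
  obtain ⟨q, T, hT, hq, hb⟩ := hgr.pair hkk
  refine ⟨q.seq p.clean, fun a => T a + (f (kk a) * mu (gr a) ^ c + 3 * p.bound + 15) + 1, ?_,
    fun a => ?_, (PolyBdd.const 3).mono fun a => mu_bool_le _⟩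
  · exact (hT.add (((hF.mul (hgr.polyBdd.pow c)).add (.const _)).add (.const 15))).add (.const 1)
  · refine (hq a).seq (Run.clean ?_)
    have := h (gr a).1 (gr a).2 (kk a) trivial
    rw [size_encodeGraph] at this
    have hs : (solve Γ (gr a) (kk a) = true) =
        VertexDeletion (fun _ : Unit => Γ) (gr a).1 (gr a).2 (kk a) :=
      propext (@decide_eq_true_iff _ (Classical.propDecidable _))
    rw [encodeInstance, encodeGraph_eq, ← hs] at this
    exact this

namespace PolyTime

variable {α : Type} [Enc α] {d : ℕ}

theorem rows {g : α → Gr} (hg : PolyTime g) : PolyTime fun a => (g a).rows := hg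

theorem of_rows {g : α → Gr} (hg : PolyTime fun a => (g a).rows) : PolyTime g := hg

theorem order {g : α → Gr} (hg : PolyTime g) : PolyTime fun a => (g a).1 :=
  hg.rows.list_length.of_eq fun a => by simp [Gr.rows]

theorem vertices {g : α → Gr} (hg : PolyTime g) : PolyTime fun a => List.range (g a).1 :=
  hg.order.list_range

theorem adj {g : α → Gr} {u v : α → ℕ} (hg : PolyTime g) (hu : PolyTime u) (hv : PolyTime v) :
    PolyTime fun a => (g a).adj (u a) (v a) :=
  list_getD enc_false (list_getD enc_list_nil hg.rows hu) hv

theorem sub {g : α → Gr} {vs : α → List ℕ} (hg : PolyTime g) (hvs : PolyTime vs) :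
    PolyTime fun a => (g a).sub (vs a) := by
  refine of_rows (of_eq ?_ fun a => ((g a).rows_sub (vs a)).symm)
  refine list_map (h := fun a u => (vs a).map fun v => (g a).adj u v) hvs ?_
  refine list_map (h := fun (x : α × ℕ) v => (g x.1).adj x.2 v) (hvs.comp id.fst) ?_
  exact adj (hg.comp id.fst.fst) id.fst.snd id.snd

theorem label_eq {f g : α → Option (Fin d)} (hf : PolyTime f) (hg : PolyTime g) :
    PolyTime fun a => decide (f a = g a) := by
  have h : PolyTime (labelCode (d := d)) := of_enc_eq (fun _ => rfl) fun _ => le_rfl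
  exact (nat_eq (h.comp hf) (h.comp hg)).of_eq fun a =>
    decide_eq_decide.2 labelCode_injective.eq_iff

theorem list_mem {l : α → List ℕ} {v : α → ℕ} (hl : PolyTime l) (hv : PolyTime v) :
    PolyTime fun a => (l a).any fun w => decide (w = v a) :=
  list_any (h := fun a w => decide (w = v a)) hl (nat_eq id.snd (hv.comp id.fst))

theorem isLabelled {l : α → List (ℕ × Option (Fin d))} {v : α → ℕ} (hl : PolyTime l)
    (hv : PolyTime v) : PolyTime fun a => isLabelled (l a) (v a) :=
  list_any (h := fun a (e : ℕ × Option (Fin d)) => decide (e.1 = v a)) hl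
    (nat_eq id.snd.fst (hv.comp id.fst))

theorem labelOf (i : Fin d) {l : α → List (ℕ × Option (Fin d))} {v : α → ℕ} (hl : PolyTime l)
    (hv : PolyTime v) : PolyTime fun a => labelOf i (l a) (v a) :=
  foldl_of_le_add (g := fun _ => some i)
    (h := fun a s (e : ℕ × Option (Fin d)) => if decide (e.1 = v a) then e.2 else s) hl
    (const _) (cond (nat_eq id.snd.snd.fst (hv.comp id.fst)) id.snd.snd.snd id.snd.fst)
    (.const (2 * d + 1)) fun _ _ _ _ => (mu_label_le _).trans (Nat.le_add_left _ _)

theorem isPending (i : Fin d) {g : α → Gr} {M : α → List ℕ} {l : α → List (ℕ × Option (Fin d))}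
    {v : α → ℕ} (hg : PolyTime g) (hM : PolyTime M) (hl : PolyTime l) (hv : PolyTime v) :
    PolyTime fun a => isPending i (g a) (M a) (l a) (v a) := by
  refine bool_and (bool_not (isLabelled hl hv)) (bool_or (list_mem hM hv) ?_)
  have hlab : PolyTime fun x : α × ℕ => Scattered.labelOf i (l x.1) x.2 :=
    labelOf i (hl.comp id.fst) id.snd
  exact list_any (h := fun a u => (g a).adj u (v a) && (!decide (Scattered.labelOf i (l a) u = none)
    && !decide (Scattered.labelOf i (l a) u = some i))) hg.vertices
    (bool_and (adj (hg.comp id.fst) id.snd (hv.comp id.fst))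
      (bool_and (bool_not (label_eq hlab (const none)))
        (bool_not (label_eq hlab (const (some i))))))

theorem expand (i : Fin d) {g : α → Gr} {M : α → List ℕ} {l : α → List (ℕ × Option (Fin d))}
    (hg : PolyTime g) (hM : PolyTime M) (hl : PolyTime l) :
    PolyTime fun a => expand i (g a) (M a) (l a) := by
  refine of_eq (list_cases (h := fun a v _ => (labels d).map fun b => (v, b) :: l a)
    (list_filter (h := fun a v => Scattered.isPending i (g a) (M a) (l a) v) hg.vertices
      (isPending i (hg.comp id.fst) (hM.comp id.fst) (hl.comp id.fst) id.snd))
    (hl.list_cons (const [])) ?_) fun a => ?_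
  · exact list_map (h := fun (x : α × ℕ × List ℕ) b => (x.2.1, b) :: l x.1) (const (labels d))
      ((id.fst.snd.fst.pair id.snd).list_cons (hl.comp id.fst.fst))
  · unfold Scattered.expand
    cases (List.range (g a).1).filter (Scattered.isPending i (g a) (M a) (l a)) <;> rfl

end PolyTime

/-! ### Size of the search tree and cost of the search. -/

theorem branches_bounds {d : ℕ} (i : Fin d) (g : Gr) (M : List ℕ) (r : List Unit) :
    (branches i g M r).length ≤ (d + 1) ^ r.length ∧
      ∀ l ∈ branches i g M r, l.length ≤ r.length ∧ ∀ e ∈ l, e.1 < g.1 := by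
  induction r using List.reverseRecOn with
  | nil => simp [branches]
  | append_singleton r a ih =>
    have hb : branches i g M (r ++ [a]) = (branches i g M r).flatMap (expand i g M) := by
      simp [branches]
    rw [hb]
    refine ⟨?_, fun l hl => ?_⟩
    · have h₁ : ∀ l, (expand i g M l).length ≤ d + 1 := fun l => by
        unfold expand
        split <;> simp [labels]
      have h₂ : ∀ S : List (List (ℕ × Option (Fin d))),
          (S.flatMap (expand i g M)).length ≤ S.length * (d + 1) := fun S => by
        induction S with
        | nil => simp
        | cons l S ih =>
          have := h₁ l
          simp only [List.flatMap_cons, List.length_append, List.length_cons]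
          linarith
      rw [List.length_append, List.length_singleton, pow_succ]
      exact (h₂ _).trans (Nat.mul_le_mul_right _ ih.1)
    · obtain ⟨l', hl', hl⟩ := List.mem_flatMap.1 hl
      obtain ⟨h₁, h₂⟩ := ih.2 l' hl'
      rw [List.length_append, List.length_singleton]
      unfold expand at hl
      split at hl
      · obtain rfl := List.mem_singleton.1 hl
        exact ⟨by omega, h₂⟩
      · rename_i v vs hf
        obtain ⟨b, -, rfl⟩ := List.mem_map.1 hl
        have hv : v ∈ (List.range g.1).filter (isPending i g M l') := by simp [hf]
        refine ⟨by simpa using h₁, fun e he => ?_⟩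
        rcases List.mem_cons.1 he with rfl | he
        · simpa using (List.mem_filter.1 hv).1
        · exact h₂ e he

/-- An instance with the bound `T` for the size of the search, and a number `B`, not encoded, that
bounds the values of `F` in question and the number of branches. -/
structure Input (d : ℕ) (F : ℕ → ℕ) where
  /-- The graph. -/
  g : Gr
  /-- The parameter. -/
  k : ℕ
  /-- The bound for the search. -/
  T : ℕ
  /-- The bound for the running time. -/
  B : ℕ
  le_T : k ≤ T
  le_B : ∀ k' ≤ T, F k' ≤ B
  pow_le_B : (d + 1) ^ (T + T) ≤ B

namespace Input

variable {d : ℕ} {F : ℕ → ℕ}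

noncomputable instance : Enc (Input d F) :=
  ⟨fun x => enc (x.g, x.k, x.T), fun x => mu (x.g, x.k, x.T) + x.B⟩

theorem B_le_mu (x : Input d F) : x.B ≤ mu x := Nat.le_add_left _ _

theorem polyTime_tuple : PolyTime fun x : Input d F => (x.g, x.k, x.T) :=
  .of_enc_eq (fun _ => rfl) fun _ => Nat.le_add_right _ _

theorem polyTime_g : PolyTime fun x : Input d F => x.g := polyTime_tuple.fst
theorem polyTime_k : PolyTime fun x : Input d F => x.k := polyTime_tuple.snd.fst
theorem polyTime_T : PolyTime fun x : Input d F => x.T := polyTime_tuple.snd.snd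

/-- All calls have parameter at most `T`, where `F` is bounded by `B` and hence by the measure. -/
theorem polyTime_solve {Γ : GraphClass} (hΓ : Solvable Γ F) {α : Type} [Enc α]
    {x : α → Input d F} {gr : α → Gr} {kk : α → ℕ} (hx : PolyTime x) (hgr : PolyTime gr)
    (hkk : PolyTime kk) (hle : ∀ a, kk a ≤ (x a).T) :
    PolyTime fun a => solve Γ (gr a) (kk a) :=
  hΓ hgr hkk (hx.polyBdd.mono fun a => ((x a).le_B _ (hle a)).trans (x a).B_le_mu)

theorem polyTime_modulator {Γ : GraphClass} (hΓ : Solvable Γ F) :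
    PolyTime fun x : Input d F => modulator Γ x.g x.T := by
  refine PolyTime.foldl_of_le_add (h := fun x M v => modStep Γ x.g x.T M v) polyTime_g.vertices
    (.const []) ?_ (polyTime_g.vertices.polyBdd.add (.const 1)) fun x M v hv => ?_
  · have hM : PolyTime fun y : Input d F × List ℕ × ℕ => y.2.1 := PolyTime.id.snd.fst
    have hvM : PolyTime fun y : Input d F × List ℕ × ℕ => y.2.2 :: y.2.1 :=
      PolyTime.id.snd.snd.list_cons hM
    have hT : PolyTime fun y : Input d F × List ℕ × ℕ => y.1.T := polyTime_T.comp PolyTime.id.fst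
    have hg : PolyTime fun y : Input d F × List ℕ × ℕ => y.1.g := polyTime_g.comp PolyTime.id.fst
    refine .cond (.bool_and (.nat_le hM.list_length.nat_succ hT)
      (polyTime_solve hΓ PolyTime.id.fst (.sub hg ?_) (.nat_sub hT hM.list_length.nat_succ)
        fun y => Nat.sub_le _ _)) hvM hM
    exact .list_filter (h := fun (y : Input d F × List ℕ × ℕ) u =>
      !(y.2.2 :: y.2.1).any fun w => decide (w = u)) hg.vertices
      (.bool_not (.list_mem (hvM.comp PolyTime.id.fst) PolyTime.id.snd))
  · have := mu_lt_of_mem hv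
    unfold modStep
    split_ifs
    · rw [mu_list_cons]; omega
    · omega

theorem polyTime_branches (i : Fin d) {M : Input d F → List ℕ} (hM : PolyTime M) :
    PolyTime fun x : Input d F =>
      branches i x.g (M x) (List.replicate x.T () ++ List.replicate x.T ()) := by
  have hT : PolyTime fun x : Input d F => List.replicate x.T () ++ List.replicate x.T () :=
    .list_append polyTime_T.replicate_unit polyTime_T.replicate_unit
  have hn := polyTime_g (F := F) (d := d).order.polyBdd
  refine PolyTime.foldl (h := fun x S _ => S.flatMap (expand i x.g (M x)))
    -- The number of branches may multiply in each round, so an additive bound per round is not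
    -- available. The two factors `mu x` bound the number of branches, through `pow_le_B`, and the
    -- number of labelled vertices in each.
    (D := fun x => mu x * (mu x * (mu x.g.1 + (2 * d + 1) + 1 + 1) + 1 + 1) + 1) hT (.const [[]])
    ?_ ?_ fun x r hr => ?_
  · exact .list_flatMap (h := fun (y : Input d F × List (List (ℕ × Option (Fin d))) × Unit) l =>
      expand i y.1.g (M y.1) l) PolyTime.id.snd.fst
      (.expand i (polyTime_g.comp PolyTime.id.fst.fst) (hM.comp PolyTime.id.fst.fst)
        PolyTime.id.snd)
  · exact (PolyBdd.measure.mul (((PolyBdd.measure.mul ((((hn.add (.const _)).add (.const 1)).add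
      (.const 1)))).add (.const 1)).add (.const 1))).add (.const 1)
  · obtain ⟨h₁, h₂⟩ := branches_bounds i x.g (M x) r
    have hrT : r.length ≤ x.T + x.T := by simpa using hr.length_le
    have hrm : r.length ≤ mu x := by
      refine hrT.trans ?_
      change _ ≤ mu x.g + (mu x.k + (2 * x.T + 1) + 1) + 1 + x.B
      omega
    have h₃ : (branches i x.g (M x) r).length ≤ mu x :=
      h₁.trans ((Nat.pow_le_pow_right (by omega) hrT).trans (x.pow_le_B.trans x.B_le_mu))
    refine (mu_list_le (m := mu x * (mu x.g.1 + (2 * d + 1) + 1 + 1) + 1) fun l hl => ?_).trans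
      (Nat.add_le_add_right (Nat.mul_le_mul_right _ h₃) 1)
    refine (mu_list_le (m := mu x.g.1 + (2 * d + 1) + 1) fun e he => ?_).trans
      (Nat.add_le_add_right (Nat.mul_le_mul_right _ ((h₂ l hl).1.trans hrm)) 1)
    have h₄ := (h₂ l hl).2 e he
    have h₅ := mu_label_le e.2
    change mu e.1 + mu e.2 + 1 ≤ _
    simp only [mu_nat]
    omega

theorem polyTime_check {Γ : Fin d → GraphClass} (hΓ : ∀ j, Solvable (Γ j) F) (i : Fin d) :
    PolyTime fun y : Input d F × List (ℕ × Option (Fin d)) => check Γ i y.1.g y.1.k y.2 := by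
  have hg : PolyTime fun y : Input d F × List (ℕ × Option (Fin d)) => y.1.g :=
    polyTime_g.comp PolyTime.id.fst
  have hk : PolyTime fun y : Input d F × List (ℕ × Option (Fin d)) => y.1.k :=
    polyTime_k.comp PolyTime.id.fst
  have hcls : ∀ b, PolyTime fun y : Input d F × List (ℕ × Option (Fin d)) =>
      (List.range y.1.g.1).filter fun v => decide (labelOf i y.2 v = b) := fun b =>
    .list_filter (h := fun (y : Input d F × List (ℕ × Option (Fin d))) v =>
      decide (labelOf i y.2 v = b)) hg.vertices
      (.label_eq (.labelOf i PolyTime.id.fst.snd PolyTime.id.snd) (.const b))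
  refine .bool_and (.nat_le (hcls none).list_length hk) (.bool_and ?_ (.fin_all fun j => ?_))
  · refine .list_all (h := fun (y : Input d F × List (ℕ × Option (Fin d))) u =>
      (List.range y.1.g.1).all fun v => !y.1.g.adj u v || (decide (labelOf i y.2 u = none) ||
        (decide (labelOf i y.2 v = none) || decide (labelOf i y.2 u = labelOf i y.2 v))))
      hg.vertices ?_
    refine .list_all (h := fun (z : (Input d F × List (ℕ × Option (Fin d))) × ℕ) v =>
      !z.1.1.g.adj z.2 v || (decide (labelOf i z.1.2 z.2 = none) ||
        (decide (labelOf i z.1.2 v = none) ||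
          decide (labelOf i z.1.2 z.2 = labelOf i z.1.2 v)))) (hg.comp PolyTime.id.fst).vertices ?_
    have hu : PolyTime fun z : ((Input d F × List (ℕ × Option (Fin d))) × ℕ) × ℕ =>
        labelOf i z.1.1.2 z.1.2 := .labelOf i PolyTime.id.fst.fst.snd PolyTime.id.fst.snd
    have hv : PolyTime fun z : ((Input d F × List (ℕ × Option (Fin d))) × ℕ) × ℕ =>
        labelOf i z.1.1.2 z.2 := .labelOf i PolyTime.id.fst.fst.snd PolyTime.id.snd
    exact .bool_or (.bool_not (.adj (hg.comp PolyTime.id.fst.fst) PolyTime.id.fst.snd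
      PolyTime.id.snd)) (.bool_or (.label_eq hu (.const none))
        (.bool_or (.label_eq hv (.const none)) (.label_eq hu hv)))
  · by_cases hj : j = i
    · simp only [if_pos hj]
      exact polyTime_solve (hΓ j) PolyTime.id.fst (.sub hg (hcls (some j)))
        (.nat_sub hk (hcls none).list_length) fun y => (Nat.sub_le _ _).trans y.1.le_T
    · simp only [if_neg hj]
      exact polyTime_solve (hΓ j) PolyTime.id.fst (.sub hg (hcls (some j))) (.const 0)
        fun y => Nat.zero_le _

theorem polyTime_algorithm {Γ : Fin d → GraphClass} (hΓ : ∀ j, Solvable (Γ j) F) :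
    PolyTime fun x : Input d F => algorithm Γ x.g x.k x.T :=
  .bool_or (.nat_le polyTime_g.order polyTime_k) (.fin_any fun i =>
    .list_any (h := fun (x : Input d F) l => check Γ i x.g x.k l)
      (polyTime_branches i (polyTime_modulator (hΓ i))) (polyTime_check hΓ i))

end Input

/-! ## Fixed-parameter tractability -/

theorem computable_add {f g : ℕ → ℕ} (hf : Computable f) (hg : Computable g) :
    Computable fun k => f k + g k :=
  Primrec.nat_add.to_comp.comp hf hg

theorem computable_mul {f g : ℕ → ℕ} (hf : Computable f) (hg : Computable g) :
    Computable fun k => f k * g k :=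
  Primrec.nat_mul.to_comp.comp hf hg

theorem computable_sum_range {f : ℕ → ℕ} (hf : Computable f) :
    Computable fun N => ∑ k ∈ Finset.range N, f k := by
  refine (Computable.nat_rec (h := fun _ (x : ℕ × ℕ) => x.2 + f x.1) Computable.id
    (Computable.const 0) ?_).of_eq fun N => ?_
  · exact Primrec.nat_add.to_comp.comp (Computable.snd.comp Computable.snd)
      (hf.comp (Computable.fst.comp Computable.snd))
  · induction N with
    | zero => rfl
    | succ N ih => rw [Finset.sum_range_succ, ← ih]; rfl

theorem computable_sum_fin {d : ℕ} {f : Fin d → ℕ → ℕ} (hf : ∀ i, Computable (f i)) :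
    Computable fun k => ∑ i, f i k := by
  induction d with
  | zero => exact (Computable.const 0).of_eq fun k => by simp
  | succ d ih =>
    exact (computable_add (hf 0) (ih fun i => hf i.succ)).of_eq fun k => by
      rw [Fin.sum_univ_succ]

theorem computable_const_pow (b : ℕ) : Computable fun N : ℕ => b ^ N := by
  refine (Computable.nat_rec (h := fun _ (x : ℕ × ℕ) => x.2 * b) Computable.id
    (Computable.const 1) ?_).of_eq fun N => ?_
  · exact Primrec.nat_mul.to_comp.comp (Computable.snd.comp Computable.snd) (Computable.const b)
  · induction N with
    | zero => rfl
    | succ N ih => rw [pow_succ, ← ih]; rfl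

theorem computable_pow_const {f : ℕ → ℕ} (hf : Computable f) (c : ℕ) :
    Computable fun k => f k ^ c := by
  induction c with
  | zero => exact (Computable.const 1).of_eq fun k => by simp
  | succ c ih => exact (computable_mul ih hf).of_eq fun k => by rw [pow_succ]

theorem Solvable.mono {Γ : GraphClass} {f F : ℕ → ℕ} (h : Solvable Γ f) (hf : ∀ k, f k ≤ F k) :
    Solvable Γ F :=
  fun hgr hkk hF => h hgr hkk (hF.mono fun _ => hf _)

/-- From a program that computes a bound for the search, a program for vertex deletion on
unbreakable graphs. -/
theorem exists_decidesWithin {d : ℕ} {Γ : Fin d → GraphClass} (hered : ∀ i, (Γ i).IsHereditary)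
    (tractable : ∀ i, FPT (VertexDeletion (fun _ : Unit => Γ i))) :
    ∃ (c : ℕ) (b : ℕ → ℕ), Computable b ∧ ∀ q : Prog, ∃ p : Prog,
      ∀ (n : ℕ) (G : SimpleGraph (Fin n)) (s k T u : ℕ), IsUnbreakable G s k → k + 3 * s ≤ T →
        Run q (enc k) (enc T) u →
        DecidesWithin p (encodeInstance G k) (VertexDeletion Γ n G k)
          ((b T + u) * (encodeGraph G).size ^ c) := by
  choose f hf hsolv using fun i => (tractable i).exists_solvable
  have hF : Computable fun k => ∑ i, f i k := computable_sum_fin hf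
  set F : ℕ → ℕ := fun k => ∑ i, f i k with hFdef
  have hsolv' : ∀ i, Solvable (Γ i) F := fun i => Solvable.mono (hsolv i) fun k =>
    Finset.single_le_sum (f := fun i => f i k) (fun _ _ => Nat.zero_le _) (Finset.mem_univ i)
  obtain ⟨r, W, ⟨c, hW⟩, hr, -⟩ := Input.polyTime_algorithm hsolv'
  -- The sum dominates `F` up to `T` without assuming `F` monotone; the power bounds the number of
  -- branches.
  let B : ℕ → ℕ := fun T => ∑ k ∈ Finset.range (T + 1), F k + (d + 1) ^ (T + T)
  have hB : Computable B := computable_add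
    ((computable_sum_range hF).comp Computable.succ)
    ((computable_const_pow (d + 1)).comp (computable_add Computable.id Computable.id))
  refine ⟨c, fun T => (T * 4 + B T + 10) ^ c + 100, computable_add (computable_pow_const
    (computable_add (computable_add (computable_mul Computable.id (Computable.const 4)) hB)
      (Computable.const 10)) c) (Computable.const 100), fun q =>
    ⟨.seq (.pair (.assign 0 (.hd (.var 0))) (.pair (.assign 0 (.tl (.var 0)))
      (.seq (.assign 0 (.tl (.var 0))) q))) r, fun n G s k T u hG hT hq => ?_⟩⟩
  let x : Input d F := ⟨⟨n, G⟩, k, T, B T, by omega, fun k' hk' => by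
    refine le_trans ?_ (Nat.le_add_right _ _)
    exact Finset.single_le_sum (f := F) (fun _ _ => Nat.zero_le _)
      (Finset.mem_range.2 (by omega)), Nat.le_add_left _ _⟩
  have hx : mu x = (encodeGraph G).size + (2 * k + 1 + (2 * T + 1) + 1) + 1 + B T := by
    rw [size_encodeGraph]
    rfl
  have h₀ : encodeInstance G k = enc ((⟨n, G⟩ : Gr), k) := by
    rw [encodeInstance, encodeGraph_eq]
    rfl
  have h₁ := Run.assign (.hd (.var 0)) (encodeInstance G k)
  have h₂ := Run.assign (.tl (.var 0)) (encodeInstance G k)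
  simp only [h₀, Expr.eval, initStore_zero, enc_mk, Data.hd, Data.tl, Expr.cost] at h₁ h₂
  -- The tree built from `G`, `k` and `T` is the encoding of `x`, since `B` is not encoded and need
  -- not be computed by the program.
  have h₃ := (h₁.pair (h₂.pair (h₂.seq hq))).seq (hr x)
  rw [← enc_mk, ← h₀] at h₃
  rw [← algorithm_eq_true_iff hered hG hT]
  refine (h₃.mono ?_).decidesWithin
  have hpos : 1 ≤ (encodeGraph G).size := by
    cases encodeGraph G <;> simp [Data.size]
  -- As `k ≤ T` and the size is positive, `mu x + 2` is at most the size times `T * 4 + B T + 10`.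
  have h₄ : W x ≤ (T * 4 + B T + 10) ^ c * (encodeGraph G).size ^ c := by
    refine (hW x).trans ?_
    rw [← mul_pow]
    refine Nat.pow_le_pow_left ?_ c
    rw [hx]
    nlinarith [Nat.zero_le (T * 4 + B T)]
  have h₅ : 100 + u ≤ (100 + u) * (encodeGraph G).size ^ c :=
    Nat.le_mul_of_pos_right _ (Nat.pow_pos hpos)
  calc _ ≤ W x + (100 + u) := by omega
    _ ≤ (T * 4 + B T + 10) ^ c * (encodeGraph G).size ^ c +
        (100 + u) * (encodeGraph G).size ^ c := Nat.add_le_add h₄ h₅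
    _ = _ := by ring

end Scattered

theorem theorem3 {d : ℕ} (Γ : Fin d → Scattered.GraphClass)
    (hered : ∀ i, (Γ i).IsHereditary)
    (tractable : ∀ i, Scattered.FPT (Scattered.VertexDeletion (fun _ : Unit => Γ i)))
    (s : ℕ → ℕ) :
    (Computable s →
      Scattered.FPTOn (Scattered.UnbreakableInstances s) (Scattered.VertexDeletion Γ)) ∧
    Scattered.NonuniformFPTOn (Scattered.UnbreakableInstances s) (Scattered.VertexDeletion Γ) := by
  open Scattered in
  obtain ⟨c, b, hb, H⟩ := exists_decidesWithin hered tractable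
  refine ⟨fun hs => ?_, c, fun k => ?_⟩
  · have hT : Computable fun k => k + 3 * s k :=
      computable_add Computable.id (computable_mul (Computable.const 3) hs)
    obtain ⟨q, u, hu, hq⟩ := exists_run_of_computable hT
    obtain ⟨p, hp⟩ := H q
    exact ⟨p, fun k => b (k + 3 * s k) + u k, c, computable_add (hb.comp hT) hu,
      fun n G k hG => hp n G (s k) k _ _ hG le_rfl (hq k)⟩
  -- For fixed `k` the threshold is a constant written into the program. The exponent `c` was chosen
  -- before this program, so it is the same for all `k`.
  · obtain ⟨p, hp⟩ := H (.assign 0 (Enc.enc (k + 3 * s k)).toExpr)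
    have hq := Run.assign (Enc.enc (k + 3 * s k)).toExpr (Enc.enc k)
    rw [Data.eval_toExpr] at hq
    exact ⟨p, _, fun n G hG => hp n G (s k) k _ _ hG le_rfl hq⟩
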